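/- **Setting.** There are $K$ arms and $N\ge 1$ stochastic experts $\pi_1,\dots,\pi_N$; each $\pi_i(\cdot\mid x)$ is a conditional probability distribution on $\{1,\dots,K\}$ given a context $x\in\mathcal X$. In each round $t=1,\dots,T$ nature draws $(x_t,r_1(t),\dots,r_K(t))$ with $r_v(t)\in[0,1]$ from a fixed distribution, independently of the past; the learner invokes an expert $k(t)$, chosen from the past (and possibly independent randomization), plays an arm $v(t)\sim\pi_{k(t)}(\cdot\mid x_t)$ and observes $Y(t)=r_{v(t)}(t)$. Let $\mu_k$ be the expected reward in a round in which expert $k$ is invoked, $\mu^*=\max_k\mu_k$, $\Delta_k=\mu^*-\mu_k$, and let $0=\Delta_{(1)}\le\Delta_{(2)}\le\dots\le\Delta_{(N)}$ be the gaps in increasing order. The regret is $R(T)=\sum_{t=1}^T(\mu^*-\mu_{k(t)})$. **Divergences.** With $f_1(x)=xe^{x-1}-1$ put $$D_{f_1}(\pi_i\Vert\pi_j)=\mathbb E_{X,\,V\sim\pi_j(\cdot\mid X)}\Big[f_1\Big(\tfrac{\pi_i(V\mid X)}{\pi_j(V\mid X)}\Big)\Big],\qquad M_{ij}=1+\log\big(1+D_{f_1}(\pi_i\Vert\pi_j)\big),$$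 where $D_{f_1}(\pi_i\Vert\pi_j)=+\infty$ if $\pi_i(\cdot\mid X)\ll\pi_j(\cdot\mid X)$ does not hold almost surely. **Algorithm (D-UCB with the adaptively clipped estimator).** In round $1$ an arbitrary, possibly random, expert is invoked. In round $t\ge2$, $k(t)$ is a maximizer over $k$ of $U_k(t-1)$ (ties broken arbitrarily, without using the current round's context and rewards), where $U_k(t)=\hat\mu_k(t)+\tfrac32\beta_k(t)$. Here $n_j(t)$ is the number of rounds up to $t$ in which expert $j$ was invoked, $Z_k(t)=\sum_j n_j(t)/M_{kj}$, $\beta_k(t)\in(0,2)$ is the solution of $\beta/\log(2/\beta)=\sqrt{16\,t\log t}/Z_k(t)$ (with $\beta_k(1)=0$), and $$\hat\mu_k(t)=\frac1{Z_k(t)}\sum_{j=1}^N\ \sum_{s\le t:\,k(s)=j}\frac{Y(s)}{M_{kj}}\,w_{kj}(s)\,\mathbf 1\big\{w_{kj}(s)\le 2\log(2/\beta_k(t))M_{kj}\big\},\qquad w_{kj}(s)=\frac{\pi_k(v(s)\mid x_s)}{\pi_j(v(s)\mid x_s)}$$ (no clipping if $\beta_k(t)=0$). **Theorem.** There is a universal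 constant $C_1>0$ such that, whenever all $M_{ij}$ are finite, with $M=\max_{i,j}M_{ij}$ and $\gamma(x)=x^2/\log^2(6/x)$, for every $T$, $$\mathbb E[R(T)]\le\frac{C_1M^2\log^2(6/\Delta_{(N)})\log T}{\Delta_{(N)}}+\frac{\pi^2}{3}\sum_{i=2}^N\Delta_{(i)}+\sum_{k=2}^{N-1}\frac{C_1M^2\log^2(6/\Delta_{(k)})\log T}{\Delta_{(k)}}\Big(1-\frac{\gamma(\Delta_{(k)})}{\gamma(\Delta_{(k+1)})}\Big),$$ where terms with a zero gap $\Delta_{(N)}=0$ or $\Delta_{(k)}=0$ in the denominator are read as $0$. -/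

import Mathlib

open MeasureTheory ProbabilityTheory

noncomputable section

/-- A contextual bandit problem with `K` arms and `N` stochastic experts. In every round nature
draws a context together with the rewards in `[0,1]` of all arms from `nature`; an expert is a
conditional distribution of the arm given the context. -/
structure ExpertBandit (𝒳 : Type*) [MeasurableSpace 𝒳] (K N : ℕ) where
  nature : Measure (𝒳 × (Fin K → unitInterval))
  nature_prob : IsProbabilityMeasure nature
  expert : Fin N → Kernel 𝒳 (Fin K)
  expert_markov : ∀ i, IsMarkovKernel (expert i)

attribute [instance] ExpertBandit.nature_prob ExpertBandit.expert_markov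

/-- The conditional `f`-divergence `E_{q_{X,V}}[f(p(V|X)/q(V|X))]` for a context distribution `ρ`
and conditional distributions `p`, `q` of `V` given `X`, for a function `f` that is bounded below
on `[0,∞)` and grows superlinearly: it is `+∞` if `p(·|x) ≪ q(·|x)` fails for a non-null set of
contexts, or if the expectation is infinite. -/
def condFDiv {𝒳 : Type*} [MeasurableSpace 𝒳] {K : ℕ} (f : ℝ → ℝ) (ρ : Measure 𝒳)
    (p q : Kernel 𝒳 (Fin K)) : EReal :=
  open Classical in
  if (∀ᵐ x ∂ρ, p x ≪ q x) ∧
      Integrable (fun z : 𝒳 × Fin K => f ((p z.1).real {z.2} / (q z.1).real {z.2})) (ρ ⊗ₘ q) then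
    ((∫ z : 𝒳 × Fin K, f ((p z.1).real {z.2} / (q z.1).real {z.2}) ∂(ρ ⊗ₘ q) : ℝ) : EReal)
  else ⊤

/-- The positive solution `β` of `β / log (2/β) = c`. It exists, is unique and lies in `(0,2)` for
every `c > 0`; for `c = 0` we take the limiting value `0`. -/
def betaSol (c : ℝ) : ℝ :=
  open Classical in
  if h : ∃ b : ℝ, 0 < b ∧ b < 2 ∧ b / Real.log (2 / b) = c then h.choose else 0

/-- `γ(x) = x² / log²(6/x)`. -/
def gammaFn (x : ℝ) : ℝ := x ^ 2 / Real.log (6 / x) ^ 2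

/-- The number `n_j(t)` of rounds among `1, …, t` in which expert `j` was invoked, when expert
`e s` is invoked in round `s`. -/
def pullCount {N : ℕ} (e : ℕ → Fin N) (j : Fin N) (t : ℕ) : ℕ :=
  ((Finset.Icc 1 t).filter fun s => e s = j).card

namespace ExpertBandit

variable {𝒳 : Type*} [MeasurableSpace 𝒳] {K N : ℕ} (B : ExpertBandit 𝒳 K N)

/-- The probability `π_i(v|x)`. -/
def prob (i : Fin N) (v : Fin K) (x : 𝒳) : ℝ := (B.expert i x).real {v}

/-- The marginal distribution of the context. -/
def contextLaw : Measure 𝒳 := B.nature.map Prod.fst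

/-- The joint distribution of `((context, reward vector), arm)` in a round in which expert `j` is
used: the arm is drawn from `π_j(·|x)`, independently of the rewards given the context `x`. -/
def roundLaw (j : Fin N) : Measure ((𝒳 × (Fin K → unitInterval)) × Fin K) :=
  B.nature ⊗ₘ ((B.expert j).comap Prod.fst measurable_fst)

/-- The expected reward `μ_j` of expert `j`. -/
def meanReward (j : Fin N) : ℝ := ∫ z, (z.1.2 z.2 : ℝ) ∂(B.roundLaw j)

/-- `μ* = max_k μ_k`. -/
def bestMean : ℝ := ⨆ k, B.meanReward k

/-- The optimality gap `Δ_k = μ* - μ_k`. -/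
def gap (k : Fin N) : ℝ := B.bestMean - B.meanReward k

/-- `Δ_(k)` for `1 ≤ k ≤ N`: the `k`-th smallest gap, counted with multiplicity. -/
def orderedGap (k : ℕ) : ℝ :=
  if h : 1 ≤ k ∧ k ≤ N then B.gap (Tuple.sort B.gap ⟨k - 1, by omega⟩) else 0

/-- The log-divergence `M_ij = 1 + log (1 + D_f(π_i ‖ π_j))` with `f(x) = x exp(x-1) - 1`. -/
def logDiv (i j : Fin N) : EReal :=
  1 + ENNReal.log
    (1 + condFDiv (fun x => x * Real.exp (x - 1) - 1) B.contextLaw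
      (B.expert i) (B.expert j)).toENNReal

/-- `M_ij` as a real number (meaningful if it is finite). -/
def M (i j : Fin N) : ℝ := (B.logDiv i j).toReal

/-- `M = max_{i,j} M_ij`. -/
def maxM : ℝ := ⨆ p : Fin N × Fin N, B.M p.1 p.2

/-- `Z_k(t) = ∑_j n_j(t) / M_kj`. -/
def Z (e : ℕ → Fin N) (k : Fin N) (t : ℕ) : ℝ :=
  ∑ j : Fin N, (pullCount e j t : ℝ) / B.M k j

/-- `β_k(t)`, the solution of `β / log (2/β) = √(16 t log t) / Z_k(t)`. -/
def beta (e : ℕ → Fin N) (k : Fin N) (t : ℕ) : ℝ :=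
  betaSol (Real.sqrt (16 * t * Real.log t) / B.Z e k t)

/-- The clipped importance sampling estimator of `μ_k` from the contexts `x s`, invoked experts
`e s`, arms `v s` and rewards `y s` of the rounds `s = 1, …, t`, with bias parameter `ε`. The
clipping level `2 log(2/ε) M_kj` is infinite for `ε = 0`. -/
def clippedEst (x : ℕ → 𝒳) (e : ℕ → Fin N) (v : ℕ → Fin K) (y : ℕ → ℝ) (ε : ℝ)
    (k : Fin N) (t : ℕ) : ℝ :=
  open Classical in
  1 / B.Z e k t * ∑ j : Fin N, ∑ s ∈ (Finset.Icc 1 t).filter (fun s => e s = j),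
    1 / B.M k j * y s * (B.prob k (v s) (x s) / B.prob j (v s) (x s)) *
      (if ε = 0 ∨ B.prob k (v s) (x s) / B.prob j (v s) (x s) ≤ 2 * Real.log (2 / ε) * B.M k j
        then 1 else 0)

/-- The index `U_k(t) = μ̂_k(t) + (3/2) β_k(t)`, where the estimator `μ̂_k(t)` is clipped adaptively
with `ε(t) = β_k(t)`. -/
def ucb (x : ℕ → 𝒳) (e : ℕ → Fin N) (v : ℕ → Fin K) (y : ℕ → ℝ) (k : Fin N) (t : ℕ) : ℝ :=
  B.clippedEst x e v y (B.beta e k t) k t + 3 / 2 * B.beta e k t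

/-- The random variables `X t` (context), `R t` (rewards of all arms), `E t` (invoked expert) and
`V t` (arm played), `1 ≤ t ≤ T`, on a probability space `(Ω, P)` form a run of D-UCB with the
clipped estimator over `T` rounds. The σ-algebra `ℱ t` describes everything that happened in the
rounds `1, …, t`, together with any randomness used to choose the expert of round `t + 1` (the
choice of the first expert and the breaking of ties). -/
structure IsDUCBRun {Ω : Type*} [mΩ : MeasurableSpace Ω] (P : Measure Ω) (ℱ : Filtration ℕ mΩ)
    (T : ℕ) (X : ℕ → Ω → 𝒳) (R : ℕ → Ω → Fin K → unitInterval) (E : ℕ → Ω → Fin N)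
    (V : ℕ → Ω → Fin K) : Prop where
  expert_meas : ∀ t, 1 ≤ t → t ≤ T → Measurable[ℱ (t - 1)] (E t)
  context_meas : ∀ t, 1 ≤ t → t ≤ T → Measurable[ℱ t] (X t)
  reward_meas : ∀ t, 1 ≤ t → t ≤ T → Measurable[ℱ t] (R t)
  arm_meas : ∀ t, 1 ≤ t → t ≤ T → Measurable[ℱ t] (V t)
  /-- Given the past, and on the event that expert `j` is invoked in round `t`, the context and
  rewards are a fresh draw from nature and the arm is drawn from `π_j(·|X t)`. -/
  round_law : ∀ t, 1 ≤ t → t ≤ T → ∀ (j : Fin N) (A : Set Ω), MeasurableSet[ℱ (t - 1)] A →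
    (P.restrict (A ∩ {ω | E t ω = j})).map (fun ω => ((X t ω, R t ω), V t ω)) =
      P (A ∩ {ω | E t ω = j}) • B.roundLaw j
  /-- From the second round on, the expert with the largest index is invoked. -/
  argmax : ∀ t, 2 ≤ t → t ≤ T → ∀ᵐ ω ∂P, ∀ i : Fin N,
    B.ucb (fun s => X s ω) (fun s => E s ω) (fun s => V s ω)
        (fun s => (R s ω (V s ω) : ℝ)) i (t - 1) ≤
      B.ucb (fun s => X s ω) (fun s => E s ω) (fun s => V s ω)
        (fun s => (R s ω (V s ω) : ℝ)) (E t ω) (t - 1)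

/-- The regret `R(T) = ∑_{t=1}^T (μ* - μ_{k(t)})` when expert `e t` is invoked in round `t`. -/
def regret (e : ℕ → Fin N) (T : ℕ) : ℝ :=
  ∑ t ∈ Finset.Icc 1 T, (B.bestMean - B.meanReward (e t))

end ExpertBandit

end

/-!
The weight `w = π_k / π_j` satisfies `E[w e^(w - 1)] = e^(M_kj - 1)` under `π_j`, so clipping it at
`L M_kj` with `L ≥ 1` costs a bias of at most `e^(1 - L)`, while the clipped reward divided by
`M_kj` stays in `[0, L]`. Hence `Z_k(t) μ̂_k(t)` is a sum of adaptively sampled variables with range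
`[0, L]`, and Hoeffding's inequality applies for every deterministic `L`. The level
`2 log (2 / β_k(t))` is random, but the clipped sum is monotone in the level, so it suffices to
control the levels in `ℕ / 12` up to `t`.

Off an event of probability `1 / t ^ 2` this gives `μ_k ≤ U_k(t)`, and
`U_k(t) ≤ μ_k + (7/2) β_k(t)` if `β_k(t) ≤ 2/3`. Invoking expert `k` in round `t + 1` then forces
`Δ_k ≤ 4 β_k(t)`, that is, `t γ(Δ_k) ≤ 1024 M ^ 2 log t`. The regret of the round is therefore at
most the largest gap satisfying this inequality; summation over `t`, followed by summation by
parts over the ordered gaps, gives the bound, and the exceptional events contribute the term with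
`π ^ 2 / 3`.
-/

section ScalarFunctions

lemma div_log_two_div_le_div_log_two_div {a b : ℝ} (ha : 0 < a) (hab : a ≤ b) (hb : b < 2) :
    a / Real.log (2 / a) ≤ b / Real.log (2 / b) := by
  have hb0 : 0 < b := ha.trans_le hab
  exact div_le_div₀ hb0.le hab (Real.log_pos ((one_lt_div hb0).2 hb))
    (Real.log_le_log (by positivity) (by gcongr))

lemma exists_div_log_two_div_eq {c : ℝ} (hc : 0 < c) :
    ∃ b : ℝ, 0 < b ∧ b < 2 ∧ b / Real.log (2 / b) = c := by
  set g : ℝ → ℝ := fun b => b - c * Real.log (2 / b) with hg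
  set a : ℝ := 2 * Real.exp (-(2 / c)) with ha
  have ha0 : 0 < a := by positivity
  have ha2 : a < 2 := by
    have : Real.exp (-(2 / c)) < 1 := Real.exp_lt_one_iff.2 (neg_lt_zero.2 (by positivity))
    linarith
  have hcont : ContinuousOn g (Set.Icc a 2) := by
    have hne : ∀ b ∈ Set.Icc a 2, b ≠ 0 := fun b hb => (ha0.trans_le hb.1).ne'
    refine continuousOn_id.sub (continuousOn_const.mul (ContinuousOn.log ?_ fun b hb => ?_))
    · exact continuousOn_const.div continuousOn_id hne
    · exact div_ne_zero two_ne_zero (hne b hb)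
  have hga : g a ≤ 0 := by
    have hlog : Real.log (2 / a) = 2 / c := by
      rw [ha, ← div_div, div_self two_ne_zero, one_div, ← Real.exp_neg, neg_neg, Real.log_exp]
    simp only [hg, hlog, mul_div_cancel₀ _ hc.ne']
    linarith
  have hg2 : 0 ≤ g 2 := by simp [hg]
  obtain ⟨b, ⟨hab, hb2⟩, hb : b - c * Real.log (2 / b) = 0⟩ :=
    intermediate_value_Icc ha2.le hcont ⟨hga, hg2⟩
  have hb0 : 0 < b := ha0.trans_le hab
  have hb2' : b < 2 := hb2.lt_of_ne fun h => by simp [h] at hb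
  refine ⟨b, hb0, hb2', ?_⟩
  rw [div_eq_iff (Real.log_pos ((one_lt_div hb0).2 hb2')).ne', ← sub_eq_zero, hb]

lemma betaSol_spec {c : ℝ} (hc : 0 < c) :
    0 < betaSol c ∧ betaSol c < 2 ∧ betaSol c / Real.log (2 / betaSol c) = c := by
  have h := exists_div_log_two_div_eq hc
  rw [betaSol, dif_pos h]
  exact h.choose_spec

lemma gammaFn_nonneg (x : ℝ) : 0 ≤ gammaFn x := div_nonneg (sq_nonneg x) (sq_nonneg _)

lemma gammaFn_pos {x : ℝ} (hx : 0 < x) (hx6 : x < 6) : 0 < gammaFn x := by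
  have : 0 < Real.log (6 / x) := Real.log_pos ((one_lt_div hx).2 hx6)
  unfold gammaFn
  positivity

lemma gammaFn_le_gammaFn {x y : ℝ} (hx : 0 < x) (hxy : x ≤ y) (hy : y < 6) :
    gammaFn x ≤ gammaFn y := by
  have hy0 : 0 < y := hx.trans_le hxy
  have hlogy : 0 < Real.log (6 / y) := Real.log_pos ((one_lt_div hy0).2 hy)
  have hlog : Real.log (6 / y) ≤ Real.log (6 / x) := Real.log_le_log (by positivity) (by gcongr)
  unfold gammaFn
  gcongr

lemma gammaFn_le_of_le_betaSol {c d : ℝ} (hc : 0 < c) (hd : 0 < d) (hd2 : d ≤ 2)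
    (h : d / 4 ≤ betaSol c) : gammaFn d ≤ 64 * c ^ 2 := by
  obtain ⟨-, hβ2, hβ⟩ := betaSol_spec hc
  have hlog6 : 0 < Real.log (6 / d) := Real.log_pos ((one_lt_div hd).2 (by linarith))
  have hlog8 : 0 < Real.log (2 / (d / 4)) := Real.log_pos ((one_lt_div (by positivity)).2
    (by linarith))
  have hlog : Real.log (2 / (d / 4)) ≤ 2 * Real.log (6 / d) := by
    rw [← Nat.cast_ofNat (R := ℝ) (n := 2), ← Real.log_pow, Nat.cast_ofNat]
    refine Real.log_le_log (by positivity) ?_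
    rw [div_pow, div_le_div_iff₀ (by positivity) (by positivity)]
    nlinarith
  have hle : d / 4 / Real.log (2 / (d / 4)) ≤ c :=
    (div_log_two_div_le_div_log_two_div (by positivity) h hβ2).trans_eq hβ
  have h8 : d / Real.log (6 / d) ≤ 8 * c := by
    rw [div_le_iff₀ hlog8] at hle
    rw [div_le_iff₀ hlog6]
    nlinarith
  calc gammaFn d = (d / Real.log (6 / d)) ^ 2 := by rw [gammaFn, div_pow]
    _ ≤ (8 * c) ^ 2 := by gcongr
    _ = 64 * c ^ 2 := by ring

lemma exp_thirteen_twelfths_le_three : Real.exp (13 / 12) ≤ 3 := by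
  have htwelfth : Real.exp (1 / 12) ≤ 12 / 11 :=
    (Real.exp_bound_div_one_sub_of_interval (by norm_num) (by norm_num)).trans_eq (by norm_num)
  calc Real.exp (13 / 12) = Real.exp 1 * Real.exp (1 / 12) := by
        rw [← Real.exp_add]; norm_num
    _ ≤ 2.7182818286 * (12 / 11) := by gcongr; exact Real.exp_one_lt_d9.le
    _ ≤ 3 := by norm_num

lemma exp_one_sub_le_half {β L : ℝ} (h0 : 0 < β) (hβ : β ≤ 2 / 3)
    (hL : 2 * Real.log (2 / β) ≤ L + 1 / 12) : Real.exp (1 - L) ≤ β / 2 := by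
  have hexp : Real.exp (-(2 * Real.log (2 / β))) = β ^ 2 / 4 := by
    rw [Real.exp_neg, two_mul, Real.exp_add, Real.exp_log (by positivity)]
    field_simp
    norm_num
  calc Real.exp (1 - L) ≤ Real.exp (13 / 12 + -(2 * Real.log (2 / β))) := by
        gcongr; linarith
    _ = Real.exp (13 / 12) * (β ^ 2 / 4) := by rw [Real.exp_add, hexp]
    _ ≤ 3 * (β ^ 2 / 4) := by gcongr; exact exp_thirteen_twelfths_le_three
    _ ≤ β / 2 := by nlinarith

end ScalarFunctions

section ImportanceWeight

variable {α ι : Type*} [MeasurableSpace α] [MeasurableSpace ι]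

/-- The importance weight `p(v|x) / q(v|x)` of a sample `(x, v)`, by which an expectation under `p`
is rewritten as an expectation under `q`. It is `0` where `q(v|x) = 0`. -/
noncomputable def importanceWeight (p q : Kernel α ι) (z : α × ι) : ℝ :=
  (p z.1).real {z.2} / (q z.1).real {z.2}

lemma importanceWeight_nonneg (p q : Kernel α ι) (z : α × ι) : 0 ≤ importanceWeight p q z :=
  div_nonneg measureReal_nonneg measureReal_nonneg

variable [Countable ι] [MeasurableSingletonClass ι]

lemma measurable_importanceWeight (p q : Kernel α ι) : Measurable (importanceWeight p q) :=
  measurable_from_prod_countable_left fun v =>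
    (p.measurable_coe (measurableSet_singleton v)).ennreal_toReal.div
      (q.measurable_coe (measurableSet_singleton v)).ennreal_toReal

lemma withDensity_importanceWeight_apply {p q : Kernel α ι} [IsFiniteKernel p] [IsFiniteKernel q]
    {x : α} (h : p x ≪ q x) :
    q.withDensity (fun x v => ENNReal.ofReal (importanceWeight p q (x, v))) x = p x := by
  have hmeas : Measurable (Function.uncurry fun x v =>
      ENNReal.ofReal (importanceWeight p q (x, v))) :=
    (measurable_importanceWeight p q).ennreal_ofReal
  refine Measure.ext_of_singleton fun v => ?_
  rw [Kernel.withDensity_apply _ hmeas, withDensity_apply _ (measurableSet_singleton v),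
    Measure.restrict_singleton, lintegral_smul_measure, lintegral_dirac, smul_eq_mul]
  rcases eq_or_ne (q x {v}) 0 with hq | hq
  · rw [hq, zero_mul, h hq]
  · have hq0 : 0 < (q x).real {v} := ENNReal.toReal_pos hq (measure_ne_top _ _)
    simp only [importanceWeight]
    rw [ENNReal.ofReal_div_of_pos hq0, ofReal_measureReal, ofReal_measureReal,
      ENNReal.mul_div_cancel hq (measure_ne_top _ _)]

variable {ρ : Measure α} [IsFiniteMeasure ρ] {p q : Kernel α ι} [IsFiniteKernel p]
  [IsFiniteKernel q]

lemma compProd_eq_withDensity_importanceWeight (h : ∀ᵐ x ∂ρ, p x ≪ q x) :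
    ρ ⊗ₘ p = (ρ ⊗ₘ q).withDensity fun z => ENNReal.ofReal (importanceWeight p q z) := by
  have hp : p =ᵐ[ρ] q.withDensity fun x v => ENNReal.ofReal (importanceWeight p q (x, v)) := by
    filter_upwards [h] with x hx using (withDensity_importanceWeight_apply hx).symm
  have : IsSFiniteKernel (q.withDensity fun x v => ENNReal.ofReal (importanceWeight p q (x, v))) :=
    Kernel.IsSFiniteKernel.withDensity q fun _ _ => ENNReal.ofReal_ne_top
  rw [Measure.compProd_congr hp]
  exact Measure.compProd_withDensity (measurable_importanceWeight p q).ennreal_ofReal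

lemma integrable_importanceWeight_mul_iff (h : ∀ᵐ x ∂ρ, p x ≪ q x) {g : α × ι → ℝ} :
    Integrable (fun z => importanceWeight p q z * g z) (ρ ⊗ₘ q) ↔ Integrable g (ρ ⊗ₘ p) := by
  rw [compProd_eq_withDensity_importanceWeight h, integrable_withDensity_iff_integrable_smul'
    (measurable_importanceWeight p q).ennreal_ofReal (.of_forall fun _ => ENNReal.ofReal_lt_top)]
  simp only [ENNReal.toReal_ofReal (importanceWeight_nonneg p q _), smul_eq_mul]

lemma integral_importanceWeight_mul (h : ∀ᵐ x ∂ρ, p x ≪ q x) (g : α × ι → ℝ) :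
    ∫ z, importanceWeight p q z * g z ∂(ρ ⊗ₘ q) = ∫ z, g z ∂(ρ ⊗ₘ p) := by
  rw [compProd_eq_withDensity_importanceWeight h, integral_withDensity_eq_integral_toReal_smul
    (measurable_importanceWeight p q).ennreal_ofReal (.of_forall fun _ => ENNReal.ofReal_lt_top)]
  simp only [ENNReal.toReal_ofReal (importanceWeight_nonneg p q _), smul_eq_mul]

end ImportanceWeight

lemma map_compProd_comap {α β ι : Type*} [MeasurableSpace α] [MeasurableSpace β]
    [MeasurableSpace ι] (ρ : Measure α) [SFinite ρ] (q : Kernel β ι) [IsSFiniteKernel q]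
    {φ : α → β} (hφ : Measurable φ) :
    (ρ ⊗ₘ q.comap φ hφ).map (Prod.map φ id) = ρ.map φ ⊗ₘ q := by
  have hφid : Measurable (Prod.map φ (id : ι → ι)) := hφ.prodMap measurable_id
  ext s hs
  rw [Measure.map_apply hφid hs, Measure.compProd_apply (hφid hs), Measure.compProd_apply hs,
    lintegral_map (Kernel.measurable_kernel_prodMk_left hs) hφ]
  rfl

section Divergence

variable {𝒳 : Type*} [MeasurableSpace 𝒳] {K : ℕ} {ρ : Measure 𝒳} {p q : Kernel 𝒳 (Fin K)}

lemma ae_absolutelyContinuous_of_condFDiv_ne_top {f : ℝ → ℝ} (h : condFDiv f ρ p q ≠ ⊤) :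
    ∀ᵐ x ∂ρ, p x ≪ q x := by
  by_contra hac
  exact h (if_neg fun hc => hac hc.1)

lemma integrable_of_condFDiv_ne_top {f : ℝ → ℝ} (h : condFDiv f ρ p q ≠ ⊤) :
    Integrable (fun z => f (importanceWeight p q z)) (ρ ⊗ₘ q) := by
  by_contra hint
  exact h (if_neg fun hc => hint hc.2)

lemma condFDiv_eq_integral {f : ℝ → ℝ} (h : condFDiv f ρ p q ≠ ⊤) :
    condFDiv f ρ p q = (∫ z, f (importanceWeight p q z) ∂(ρ ⊗ₘ q) : ℝ) :=
  if_pos ⟨ae_absolutelyContinuous_of_condFDiv_ne_top h, integrable_of_condFDiv_ne_top h⟩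

lemma two_mul_sub_one_le_mul_exp {w : ℝ} (hw : 0 ≤ w) : 2 * w - 1 ≤ w * Real.exp (w - 1) := by
  nlinarith [sq_nonneg (w - 1), Real.add_one_le_exp (w - 1)]

variable [IsProbabilityMeasure ρ] [IsMarkovKernel q]

lemma integrable_importanceWeight_mul_exp
    (h : condFDiv (fun x => x * Real.exp (x - 1) - 1) ρ p q ≠ ⊤) :
    Integrable (fun z => importanceWeight p q z * Real.exp (importanceWeight p q z - 1))
      (ρ ⊗ₘ q) := by
  simpa only [sub_eq_add_neg, integrable_add_const_iff] using integrable_of_condFDiv_ne_top h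

lemma condFDiv_eq_integral_mul_exp_sub_one
    (h : condFDiv (fun x => x * Real.exp (x - 1) - 1) ρ p q ≠ ⊤) :
    condFDiv (fun x => x * Real.exp (x - 1) - 1) ρ p q =
      (∫ z, importanceWeight p q z * Real.exp (importanceWeight p q z - 1) ∂(ρ ⊗ₘ q) - 1 : ℝ) := by
  rw [condFDiv_eq_integral h, integral_sub (integrable_importanceWeight_mul_exp h)
    (integrable_const 1), integral_const, probReal_univ, one_smul]

lemma one_le_integral_importanceWeight_mul_exp [IsMarkovKernel p]
    (h : condFDiv (fun x => x * Real.exp (x - 1) - 1) ρ p q ≠ ⊤) :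
    1 ≤ ∫ z, importanceWeight p q z * Real.exp (importanceWeight p q z - 1) ∂(ρ ⊗ₘ q) := by
  have hac := ae_absolutelyContinuous_of_condFDiv_ne_top h
  have hint : Integrable (importanceWeight p q) (ρ ⊗ₘ q) := by
    simpa using (integrable_importanceWeight_mul_iff hac).2 (integrable_const 1)
  have hmass : ∫ z, importanceWeight p q z ∂(ρ ⊗ₘ q) = 1 := by
    simpa using integral_importanceWeight_mul hac fun _ => 1
  calc (1 : ℝ) = ∫ z, (2 * importanceWeight p q z - 1) ∂(ρ ⊗ₘ q) := by
        rw [integral_sub (hint.const_mul 2) (integrable_const 1), integral_const_mul, hmass,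
          integral_const, probReal_univ, one_smul]
        norm_num
    _ ≤ _ := integral_mono ((hint.const_mul 2).sub (integrable_const 1))
        (integrable_importanceWeight_mul_exp h)
        fun z => two_mul_sub_one_le_mul_exp (importanceWeight_nonneg p q z)

end Divergence

section Clipping

/-- The clipped weight of a clipped importance sampling estimator: weights above the level `c` are
discarded rather than truncated to `c`. -/
noncomputable def clip (c w : ℝ) : ℝ :=
  if w ≤ c then w else 0

lemma clip_nonneg (c : ℝ) {w : ℝ} (hw : 0 ≤ w) : 0 ≤ clip c w := by
  unfold clip; split_ifs <;> simp [hw]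

lemma clip_le_level {c : ℝ} (hc : 0 ≤ c) (w : ℝ) : clip c w ≤ c := by
  unfold clip; split_ifs with h <;> simp [h, hc]

lemma clip_le_self (c : ℝ) {w : ℝ} (hw : 0 ≤ w) : clip c w ≤ w := by
  unfold clip; split_ifs <;> simp [hw]

lemma clip_le_clip {c c' w : ℝ} (hc : c ≤ c') (hw : 0 ≤ w) : clip c w ≤ clip c' w := by
  unfold clip
  split_ifs with h h'
  · rfl
  · exact absurd (h.trans hc) h'
  · exact hw
  · rfl

@[fun_prop]
lemma measurable_clip (c : ℝ) : Measurable (clip c) :=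
  Measurable.ite measurableSet_Iic measurable_id measurable_const

lemma sub_clip_le (c : ℝ) {w : ℝ} (hw : 0 ≤ w) :
    w - clip c w ≤ Real.exp (1 - c) * (w * Real.exp (w - 1)) := by
  unfold clip
  split_ifs with h
  · rw [sub_self]; positivity
  · have hexp : 1 ≤ Real.exp (1 - c) * Real.exp (w - 1) := by
      rw [← Real.exp_add]
      exact Real.one_le_exp (by linarith)
    calc w - 0 ≤ w * (Real.exp (1 - c) * Real.exp (w - 1)) := by
          rw [sub_zero]; exact le_mul_of_one_le_right hw hexp
      _ = _ := by ring

variable {α ι : Type*} [MeasurableSpace α] [MeasurableSpace ι] [Countable ι]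
  [MeasurableSingletonClass ι] {ρ : Measure α} [IsFiniteMeasure ρ] {p q : Kernel α ι}
  [IsFiniteKernel q] {r : α × ι → ℝ} (hr : Measurable r) (hr01 : ∀ z, r z ∈ Set.Icc 0 1)

include hr hr01

lemma integrable_clip_importanceWeight_mul {c : ℝ} (hc : 0 ≤ c) :
    Integrable (fun z => clip c (importanceWeight p q z) * r z) (ρ ⊗ₘ q) := by
  refine Integrable.of_mem_Icc 0 c
    (((measurable_clip c).comp (measurable_importanceWeight p q)).mul hr).aemeasurable
    (.of_forall fun z => ?_)
  have hclip := clip_nonneg c (importanceWeight_nonneg p q z)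
  exact ⟨mul_nonneg hclip (hr01 z).1, (mul_le_of_le_one_right hclip (hr01 z).2).trans
    (clip_le_level hc _)⟩

variable [IsFiniteKernel p]

lemma integral_clip_importanceWeight_mul_le (h : ∀ᵐ x ∂ρ, p x ≪ q x) {c : ℝ} (hc : 0 ≤ c) :
    ∫ z, clip c (importanceWeight p q z) * r z ∂(ρ ⊗ₘ q) ≤ ∫ z, r z ∂(ρ ⊗ₘ p) := by
  have hint : Integrable r (ρ ⊗ₘ p) := Integrable.of_mem_Icc 0 1 hr.aemeasurable (.of_forall hr01)
  rw [← integral_importanceWeight_mul h r]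
  refine integral_mono (integrable_clip_importanceWeight_mul hr hr01 hc)
    ((integrable_importanceWeight_mul_iff h).2 hint) fun z => ?_
  exact mul_le_mul_of_nonneg_right (clip_le_self c (importanceWeight_nonneg p q z)) (hr01 z).1

lemma sub_le_integral_clip_importanceWeight_mul (h : ∀ᵐ x ∂ρ, p x ≪ q x) {c : ℝ} (hc : 0 ≤ c)
    (hexp : Integrable (fun z => importanceWeight p q z * Real.exp (importanceWeight p q z - 1))
      (ρ ⊗ₘ q)) :
    ∫ z, r z ∂(ρ ⊗ₘ p) - Real.exp (1 - c) *
        ∫ z, importanceWeight p q z * Real.exp (importanceWeight p q z - 1) ∂(ρ ⊗ₘ q) ≤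
      ∫ z, clip c (importanceWeight p q z) * r z ∂(ρ ⊗ₘ q) := by
  have hint : Integrable r (ρ ⊗ₘ p) := Integrable.of_mem_Icc 0 1 hr.aemeasurable (.of_forall hr01)
  have hwr := (integrable_importanceWeight_mul_iff h).2 hint
  rw [← integral_importanceWeight_mul h r, ← integral_const_mul,
    ← integral_sub hwr (hexp.const_mul _)]
  refine integral_mono (hwr.sub (hexp.const_mul _))
    (integrable_clip_importanceWeight_mul hr hr01 hc) fun z => ?_
  have hw := importanceWeight_nonneg p q z
  have hclip : (importanceWeight p q z - clip c (importanceWeight p q z)) * r z ≤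
      importanceWeight p q z - clip c (importanceWeight p q z) :=
    mul_le_of_le_one_right (sub_nonneg.2 (clip_le_self c hw)) (hr01 z).2
  simp only
  linarith [sub_clip_le c hw]

end Clipping

section AdaptiveSampling

variable {ι 𝒵 Ω : Type*} [MeasurableSpace ι] [MeasurableSpace 𝒵] [mΩ : MeasurableSpace Ω]

/-- Adaptive sampling from the laws `ν j` over `T` rounds: in round `t` the index `E t` is chosen
from the information `ℱ (t - 1)` on the past, and then `W t` is a fresh draw from `ν (E t)`. -/
structure IsAdaptiveSample (P : Measure Ω) (ℱ : Filtration ℕ mΩ) (ν : ι → Measure 𝒵) (T : ℕ)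
    (E : ℕ → Ω → ι) (W : ℕ → Ω → 𝒵) : Prop where
  measurable_index : ∀ t, 1 ≤ t → t ≤ T → Measurable[ℱ (t - 1)] (E t)
  measurable_sample : ∀ t, 1 ≤ t → t ≤ T → Measurable[ℱ t] (W t)
  map_restrict : ∀ t, 1 ≤ t → t ≤ T → ∀ (j : ι) (A : Set Ω), MeasurableSet[ℱ (t - 1)] A →
    (P.restrict (A ∩ E t ⁻¹' {j})).map (W t) = P (A ∩ E t ⁻¹' {j}) • ν j

/-- The sum over the rounds `1, …, t` of the deviations of the observed values `f (e s) (z s)` from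
their means under the sampling laws `ν (e s)`. -/
noncomputable def centeredSum (ν : ι → Measure 𝒵) (f : ι → 𝒵 → ℝ) (e : ℕ → ι) (z : ℕ → 𝒵)
    (t : ℕ) : ℝ :=
  ∑ s ∈ Finset.Icc 1 t, (f (e s) (z s) - ∫ y, f (e s) y ∂(ν (e s)))

variable {P : Measure Ω} {ℱ : Filtration ℕ mΩ} {ν : ι → Measure 𝒵} {T : ℕ}
  {E : ℕ → Ω → ι} {W : ℕ → Ω → 𝒵}

lemma IsAdaptiveSample.setLIntegral_mul [MeasurableSingletonClass ι]
    (h : IsAdaptiveSample P ℱ ν T E W) {t : ℕ} (h1 : 1 ≤ t)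
    (ht : t ≤ T) (j : ι) {φ : 𝒵 → ENNReal} (hφ : Measurable φ) {g : Ω → ENNReal}
    (hg : Measurable[ℱ (t - 1)] g) :
    ∫⁻ ω in E t ⁻¹' {j}, g ω * φ (W t ω) ∂P = (∫⁻ ω in E t ⁻¹' {j}, g ω ∂P) * ∫⁻ z, φ z ∂(ν j) := by
  set S := E t ⁻¹' {j}
  have hle := ℱ.le (t - 1)
  have hW : Measurable (W t) := (h.measurable_sample t h1 ht).mono (ℱ.le t) le_rfl
  have hlaw : ((P.restrict S).withDensity (φ ∘ W t)).trim hle =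
      (∫⁻ z, φ z ∂(ν j)) • (P.restrict S).trim hle := by
    refine @Measure.ext _ (ℱ (t - 1)) _ _ fun A hA => ?_
    rw [trim_measurableSet_eq hle hA, withDensity_apply _ (hle A hA),
      Measure.restrict_restrict (hle A hA), Measure.smul_apply, trim_measurableSet_eq hle hA,
      Measure.restrict_apply (hle A hA)]
    simp only [Function.comp_apply]
    rw [← lintegral_map hφ hW, h.map_restrict t h1 ht j A hA, lintegral_smul_measure, smul_eq_mul,
      smul_eq_mul, mul_comm]
  calc ∫⁻ ω in S, g ω * φ (W t ω) ∂P
      = ∫⁻ ω, g ω ∂(P.restrict S).withDensity (φ ∘ W t) := by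
        rw [lintegral_withDensity_eq_lintegral_mul _ (hφ.comp hW) (hg.mono hle le_rfl)]
        simp only [Pi.mul_apply, Function.comp_apply, mul_comm]
    _ = (∫⁻ ω in S, g ω ∂P) * ∫⁻ z, φ z ∂(ν j) := by
        rw [← lintegral_trim hle hg, hlaw, lintegral_smul_measure, lintegral_trim hle hg,
          smul_eq_mul, mul_comm]

variable [Countable ι] [MeasurableSingletonClass ι]

lemma lintegral_eq_tsum_setLIntegral_fiber (P : Measure Ω) {E : Ω → ι} (hE : Measurable E)
    (f : Ω → ENNReal) : ∫⁻ ω, f ω ∂P = ∑' j, ∫⁻ ω in E ⁻¹' {j}, f ω ∂P := by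
  rw [← lintegral_iUnion (fun j => hE (measurableSet_singleton j)) (pairwise_disjoint_fiber E),
    ← Set.preimage_iUnion, Set.iUnion_of_singleton, Set.preimage_univ, setLIntegral_univ]

namespace IsAdaptiveSample

lemma measurable_comp (h : IsAdaptiveSample P ℱ ν T E W) {β : Type*} [MeasurableSpace β]
    {φ : ι → 𝒵 → β} (hφ : ∀ j, Measurable (φ j)) {t : ℕ} (h1 : 1 ≤ t) (ht : t ≤ T) :
    Measurable[ℱ t] fun ω => φ (E t ω) (W t ω) := by
  have hφ' : Measurable (Function.uncurry φ) := measurable_from_prod_countable_right hφ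
  exact hφ'.comp (((h.measurable_index t h1 ht).mono (ℱ.mono (Nat.sub_le t 1)) le_rfl).prodMk
    (h.measurable_sample t h1 ht))

lemma measurable_prod (h : IsAdaptiveSample P ℱ ν T E W) {φ : ι → 𝒵 → ENNReal}
    (hφ : ∀ j, Measurable (φ j)) {t : ℕ} (ht : t ≤ T) :
    Measurable[ℱ t] fun ω => ∏ s ∈ Finset.Icc 1 t, φ (E s ω) (W s ω) := by
  refine Finset.measurable_fun_prod _ fun s hs => ?_
  obtain ⟨h1, hst⟩ := Finset.mem_Icc.1 hs
  exact (h.measurable_comp hφ h1 (hst.trans ht)).mono (ℱ.mono hst) le_rfl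

lemma measurable_centeredSum (h : IsAdaptiveSample P ℱ ν T E W) {f : ι → 𝒵 → ℝ}
    (hf : ∀ j, Measurable (f j)) {t : ℕ} (ht : t ≤ T) :
    Measurable fun ω => centeredSum ν f (E · ω) (W · ω) t := by
  refine Finset.measurable_fun_sum _ fun s hs => ?_
  obtain ⟨h1, hst⟩ := Finset.mem_Icc.1 hs
  exact (h.measurable_comp (φ := fun j z => f j z - ∫ y, f j y ∂(ν j))
    (fun j => (hf j).sub_const _) h1 (hst.trans ht)).mono (ℱ.le s) le_rfl

lemma lintegral_prod_le [IsProbabilityMeasure P] (h : IsAdaptiveSample P ℱ ν T E W)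
    {φ : ι → 𝒵 → ENNReal} (hφ : ∀ j, Measurable (φ j)) {κ : ENNReal}
    (hκ : ∀ j, ∫⁻ z, φ j z ∂(ν j) ≤ κ) {t : ℕ} (ht : t ≤ T) :
    ∫⁻ ω, ∏ s ∈ Finset.Icc 1 t, φ (E s ω) (W s ω) ∂P ≤ κ ^ t := by
  induction t with
  | zero => simp
  | succ t ih =>
    have h1 : 1 ≤ t + 1 := Nat.le_add_left 1 t
    have hE : Measurable (E (t + 1)) := (h.measurable_index _ h1 ht).mono (ℱ.le _) le_rfl
    set G : Ω → ENNReal := fun ω => ∏ s ∈ Finset.Icc 1 t, φ (E s ω) (W s ω)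
    have hG : Measurable[ℱ (t + 1 - 1)] G := h.measurable_prod hφ (Nat.le_of_succ_le ht)
    calc ∫⁻ ω, ∏ s ∈ Finset.Icc 1 (t + 1), φ (E s ω) (W s ω) ∂P
        = ∑' j, ∫⁻ ω in E (t + 1) ⁻¹' {j}, G ω * φ j (W (t + 1) ω) ∂P := by
          rw [lintegral_eq_tsum_setLIntegral_fiber P hE]
          refine tsum_congr fun j => setLIntegral_congr_fun (hE (measurableSet_singleton j)) ?_
          rintro ω rfl
          exact Finset.prod_Icc_succ_top h1 _
      _ ≤ ∑' j, (∫⁻ ω in E (t + 1) ⁻¹' {j}, G ω ∂P) * κ := by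
          refine ENNReal.tsum_le_tsum fun j => ?_
          rw [h.setLIntegral_mul h1 ht j (hφ j) hG]
          gcongr
          exact hκ j
      _ = (∫⁻ ω, G ω ∂P) * κ := by
          rw [ENNReal.tsum_mul_right, ← lintegral_eq_tsum_setLIntegral_fiber P hE]
      _ ≤ κ ^ t * κ := by gcongr; exact ih (Nat.le_of_succ_le ht)
      _ = κ ^ (t + 1) := (pow_succ _ _).symm

lemma lintegral_exp_centeredSum_le [IsProbabilityMeasure P] (h : IsAdaptiveSample P ℱ ν T E W)
    {f : ι → 𝒵 → ℝ} (hf : ∀ j, Measurable (f j)) {c : NNReal}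
    (hsub : ∀ j, HasSubgaussianMGF (fun z => f j z - ∫ y, f j y ∂(ν j)) c (ν j)) {t : ℕ}
    (ht : t ≤ T) (l : ℝ) :
    ∫⁻ ω, ENNReal.ofReal (Real.exp (l * centeredSum ν f (E · ω) (W · ω) t)) ∂P ≤
      ENNReal.ofReal (Real.exp ((t * c : NNReal) * l ^ 2 / 2)) := by
  set φ : ι → 𝒵 → ENNReal := fun j z =>
    ENNReal.ofReal (Real.exp (l * (f j z - ∫ y, f j y ∂(ν j))))
  have hφ : ∀ j, Measurable (φ j) := fun j =>
    (Real.measurable_exp.comp (((hf j).sub_const _).const_mul l)).ennreal_ofReal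
  have hκ : ∀ j, ∫⁻ z, φ j z ∂(ν j) ≤ ENNReal.ofReal (Real.exp (c * l ^ 2 / 2)) := fun j => by
    rw [← ofReal_integral_eq_lintegral_ofReal ((hsub j).integrable_exp_mul l)
      (.of_forall fun z => (Real.exp_pos _).le)]
    exact ENNReal.ofReal_le_ofReal ((hsub j).mgf_le l)
  have hprod : ∀ ω, ENNReal.ofReal (Real.exp (l * centeredSum ν f (E · ω) (W · ω) t)) =
      ∏ s ∈ Finset.Icc 1 t, φ (E s ω) (W s ω) := fun ω => by
    rw [centeredSum, Finset.mul_sum, Real.exp_sum,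
      ENNReal.ofReal_prod_of_nonneg fun s _ => (Real.exp_pos _).le]
  simp only [hprod]
  refine (h.lintegral_prod_le hφ hκ ht).trans_eq ?_
  rw [← ENNReal.ofReal_pow (Real.exp_pos _).le, ← Real.exp_nat_mul]
  push_cast
  ring_nf

lemma hasSubgaussianMGF_centeredSum [IsProbabilityMeasure P] (h : IsAdaptiveSample P ℱ ν T E W)
    {f : ι → 𝒵 → ℝ} (hf : ∀ j, Measurable (f j)) {c : NNReal}
    (hsub : ∀ j, HasSubgaussianMGF (fun z => f j z - ∫ y, f j y ∂(ν j)) c (ν j)) {t : ℕ}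
    (ht : t ≤ T) :
    HasSubgaussianMGF (fun ω => centeredSum ν f (E · ω) (W · ω) t) (t * c) P := by
  have hmeas : ∀ l, Measurable fun ω => Real.exp (l * centeredSum ν f (E · ω) (W · ω) t) :=
    fun l => Real.measurable_exp.comp ((h.measurable_centeredSum hf ht).const_mul l)
  have hpos : ∀ l, 0 ≤ᵐ[P] fun ω => Real.exp (l * centeredSum ν f (E · ω) (W · ω) t) :=
    fun l => .of_forall fun ω => (Real.exp_pos _).le
  have hbound := h.lintegral_exp_centeredSum_le hf hsub ht
  refine ⟨fun l => ⟨(hmeas l).aestronglyMeasurable, ?_⟩, fun l => ?_⟩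
  · rw [hasFiniteIntegral_iff_ofReal (hpos l)]
    exact (hbound l).trans_lt ENNReal.ofReal_lt_top
  · rw [mgf, integral_eq_lintegral_of_nonneg_ae (hpos l) (hmeas l).aestronglyMeasurable]
    exact ENNReal.toReal_le_of_le_ofReal (Real.exp_pos _).le (hbound l)

lemma measureReal_le_abs_centeredSum_le [IsProbabilityMeasure P] [∀ j, IsProbabilityMeasure (ν j)]
    (h : IsAdaptiveSample P ℱ ν T E W) {f : ι → 𝒵 → ℝ} (hf : ∀ j, Measurable (f j)) {a b : ℝ}
    (hfab : ∀ j z, f j z ∈ Set.Icc a b) {t : ℕ} (ht : t ≤ T) {ε : ℝ} (hε : 0 ≤ ε) :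
    P.real {ω | ε ≤ |centeredSum ν f (E · ω) (W · ω) t|} ≤
      2 * Real.exp (-(2 * ε ^ 2 / (t * (b - a) ^ 2))) := by
  have hsub := h.hasSubgaussianMGF_centeredSum hf
    (fun j => hasSubgaussianMGF_of_mem_Icc (hf j).aemeasurable (.of_forall (hfab j))) ht
  have hexp : -ε ^ 2 / (2 * (t * (‖b - a‖₊ / 2) ^ 2 : NNReal)) =
      -(2 * ε ^ 2 / (t * (b - a) ^ 2)) := by
    push_cast
    rw [Real.norm_eq_abs, div_pow, sq_abs, ← neg_div, neg_mul_eq_mul_neg,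
      show (2 : ℝ) * (t * ((b - a) ^ 2 / 2 ^ 2)) = t * (b - a) ^ 2 / 2 by ring, div_div_eq_mul_div,
      mul_comm]
  have hupper := hsub.measure_ge_le hε
  have hlower := hsub.neg.measure_ge_le hε
  rw [hexp] at hupper hlower
  calc P.real {ω | ε ≤ |centeredSum ν f (E · ω) (W · ω) t|}
      ≤ P.real ({ω | ε ≤ centeredSum ν f (E · ω) (W · ω) t} ∪
          {ω | ε ≤ -centeredSum ν f (E · ω) (W · ω) t}) :=
        measureReal_mono fun ω (hω : ε ≤ |_|) => le_abs.1 hω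
    _ ≤ _ := (measureReal_union_le _ _).trans (by rw [two_mul]; exact add_le_add hupper hlower)

end IsAdaptiveSample

end AdaptiveSampling

namespace ExpertBandit

variable {𝒳 : Type*} [MeasurableSpace 𝒳] {K N : ℕ} (B : ExpertBandit 𝒳 K N)

instance : IsProbabilityMeasure B.contextLaw :=
  Measure.isProbabilityMeasure_map measurable_fst.aemeasurable

instance (j : Fin N) : IsProbabilityMeasure (B.roundLaw j) := by
  unfold roundLaw; infer_instance

section Reward

lemma measurable_reward :
    Measurable fun z : (𝒳 × (Fin K → unitInterval)) × Fin K => (z.1.2 z.2 : ℝ) :=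
  measurable_from_prod_countable_left fun v =>
    measurable_subtype_coe.comp ((measurable_pi_apply v).comp measurable_snd)

lemma integrable_reward (j : Fin N) :
    Integrable (fun z : (𝒳 × (Fin K → unitInterval)) × Fin K => (z.1.2 z.2 : ℝ))
      (B.roundLaw j) :=
  Integrable.of_mem_Icc 0 1 measurable_reward.aemeasurable (.of_forall fun z => (z.1.2 z.2).2)

lemma meanReward_nonneg (j : Fin N) : 0 ≤ B.meanReward j :=
  integral_nonneg fun z => (z.1.2 z.2).2.1

lemma meanReward_le_one (j : Fin N) : B.meanReward j ≤ 1 := by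
  calc B.meanReward j ≤ ∫ _, 1 ∂(B.roundLaw j) :=
        integral_mono (B.integrable_reward j) (integrable_const 1) fun z => (z.1.2 z.2).2.2
    _ = 1 := by simp

end Reward

section LogDivergence

variable {B} {i j : Fin N}

lemma condFDiv_ne_top_of_logDiv_ne_top (h : B.logDiv i j ≠ ⊤) :
    condFDiv (fun x => x * Real.exp (x - 1) - 1) B.contextLaw (B.expert i) (B.expert j) ≠ ⊤ := by
  have htop : (1 : EReal) + ⊤ = ⊤ := EReal.add_top_of_ne_bot (EReal.coe_ne_bot 1)
  intro hD
  exact h (by rw [logDiv, hD, htop, EReal.toENNReal_top, ENNReal.log_top, htop])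

lemma M_eq_one_add_log (h : B.logDiv i j ≠ ⊤) :
    B.M i j = 1 + Real.log (∫ z, importanceWeight (B.expert i) (B.expert j) z *
      Real.exp (importanceWeight (B.expert i) (B.expert j) z - 1)
        ∂(B.contextLaw ⊗ₘ B.expert j)) := by
  have hD := condFDiv_ne_top_of_logDiv_ne_top h
  rw [M, logDiv, condFDiv_eq_integral_mul_exp_sub_one hD, ← EReal.coe_one, ← EReal.coe_add,
    add_sub_cancel, EReal.toENNReal_of_ne_top (EReal.coe_ne_top _), EReal.toReal_coe,
    ENNReal.log_ofReal_of_pos (zero_lt_one.trans_le (one_le_integral_importanceWeight_mul_exp hD)),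
    ← EReal.coe_add, EReal.toReal_coe]

lemma one_le_M (h : B.logDiv i j ≠ ⊤) : 1 ≤ B.M i j := by
  rw [M_eq_one_add_log h, le_add_iff_nonneg_right]
  exact Real.log_nonneg
    (one_le_integral_importanceWeight_mul_exp (condFDiv_ne_top_of_logDiv_ne_top h))

lemma integral_importanceWeight_mul_exp (h : B.logDiv i j ≠ ⊤) :
    ∫ z, importanceWeight (B.expert i) (B.expert j) z *
      Real.exp (importanceWeight (B.expert i) (B.expert j) z - 1)
        ∂(B.contextLaw ⊗ₘ B.expert j) = Real.exp (B.M i j - 1) := by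
  rw [M_eq_one_add_log h, add_sub_cancel_left, Real.exp_log (zero_lt_one.trans_le
    (one_le_integral_importanceWeight_mul_exp (condFDiv_ne_top_of_logDiv_ne_top h)))]

lemma M_le_maxM (i j : Fin N) : B.M i j ≤ B.maxM :=
  le_ciSup (f := fun p : Fin N × Fin N => B.M p.1 p.2) (Set.finite_range _).bddAbove (i, j)

end LogDivergence

section ClippedReward

/-- The contribution to the clipped estimator of `μ_k` of a round `z` in which expert `j` is
invoked, when the importance weight is clipped at the level `L * M_kj`. -/
noncomputable def clippedReward (k : Fin N) (L : ℝ) (j : Fin N)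
    (z : (𝒳 × (Fin K → unitInterval)) × Fin K) : ℝ :=
  1 / B.M k j * (clip (L * B.M k j) (importanceWeight (B.expert k) (B.expert j) (z.1.1, z.2)) *
    z.1.2 z.2)

variable {k j : Fin N} {L : ℝ}

lemma measurable_clippedReward (k : Fin N) (L : ℝ) (j : Fin N) :
    Measurable (B.clippedReward k L j) := by
  have hw : Measurable fun z : (𝒳 × (Fin K → unitInterval)) × Fin K =>
      importanceWeight (B.expert k) (B.expert j) (z.1.1, z.2) :=
    (measurable_importanceWeight _ _).comp (measurable_fst.prodMap measurable_id)
  exact (((measurable_clip _).comp hw).mul measurable_reward).const_mul _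

variable {B}

lemma clippedReward_mem_Icc (h : B.logDiv k j ≠ ⊤) (hL : 0 ≤ L)
    (z : (𝒳 × (Fin K → unitInterval)) × Fin K) : B.clippedReward k L j z ∈ Set.Icc 0 L := by
  have hM : 0 < B.M k j := zero_lt_one.trans_le (one_le_M h)
  have hr := (z.1.2 z.2).2
  have hclip := clip_nonneg (L * B.M k j)
    (importanceWeight_nonneg (B.expert k) (B.expert j) (z.1.1, z.2))
  refine ⟨mul_nonneg (by positivity) (mul_nonneg hclip hr.1), ?_⟩
  rw [clippedReward, one_div_mul_eq_div, div_le_iff₀ hM]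
  exact (mul_le_of_le_one_right hclip hr.2).trans (clip_le_level (by positivity) _)

lemma clippedReward_le_clippedReward (h : B.logDiv k j ≠ ⊤) {L' : ℝ} (hL : L ≤ L')
    (z : (𝒳 × (Fin K → unitInterval)) × Fin K) :
    B.clippedReward k L j z ≤ B.clippedReward k L' j z := by
  have hM : 0 < B.M k j := zero_lt_one.trans_le (one_le_M h)
  have hclip := clip_le_clip (mul_le_mul_of_nonneg_right hL hM.le)
    (importanceWeight_nonneg (B.expert k) (B.expert j) (z.1.1, z.2))
  exact mul_le_mul_of_nonneg_left (mul_le_mul_of_nonneg_right hclip (z.1.2 z.2).2.1)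
    (by positivity)

/-- The conditional distribution of the arm under expert `j`, as a kernel from pairs of a context
and a reward vector; it ignores the rewards. -/
noncomputable abbrev roundExpert (B : ExpertBandit 𝒳 K N) (j : Fin N) :
    Kernel (𝒳 × (Fin K → unitInterval)) (Fin K) :=
  (B.expert j).comap Prod.fst measurable_fst

lemma map_fst_roundLaw (j : Fin N) :
    (B.roundLaw j).map (Prod.map Prod.fst id) = B.contextLaw ⊗ₘ B.expert j :=
  map_compProd_comap B.nature (B.expert j) measurable_fst

lemma ae_roundExpert_absolutelyContinuous (h : B.logDiv k j ≠ ⊤) :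
    ∀ᵐ y ∂B.nature, B.roundExpert k y ≪ B.roundExpert j y :=
  ae_of_ae_map measurable_fst.aemeasurable
    (ae_absolutelyContinuous_of_condFDiv_ne_top (condFDiv_ne_top_of_logDiv_ne_top h))

lemma integral_clippedReward_le (h : B.logDiv k j ≠ ⊤) (hL : 0 ≤ L) :
    ∫ z, B.clippedReward k L j z ∂(B.roundLaw j) ≤ B.meanReward k / B.M k j := by
  have hM : 0 < B.M k j := zero_lt_one.trans_le (one_le_M h)
  simp only [clippedReward]
  rw [integral_const_mul, one_div_mul_eq_div]
  gcongr
  exact integral_clip_importanceWeight_mul_le measurable_reward (fun z => (z.1.2 z.2).2)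
    (ae_roundExpert_absolutelyContinuous h) (mul_nonneg hL hM.le)

lemma le_integral_clippedReward (h : B.logDiv k j ≠ ⊤) (hL : 1 ≤ L) :
    (B.meanReward k - Real.exp (1 - L)) / B.M k j ≤
      ∫ z, B.clippedReward k L j z ∂(B.roundLaw j) := by
  have hM1 : 1 ≤ B.M k j := one_le_M h
  have hM : 0 < B.M k j := zero_lt_one.trans_le hM1
  set g : 𝒳 × Fin K → ℝ := fun z => importanceWeight (B.expert k) (B.expert j) z *
    Real.exp (importanceWeight (B.expert k) (B.expert j) z - 1)
  have hφ : Measurable (Prod.map Prod.fst id :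
      (𝒳 × (Fin K → unitInterval)) × Fin K → 𝒳 × Fin K) := measurable_fst.prodMap measurable_id
  have hg : Integrable g ((B.roundLaw j).map (Prod.map Prod.fst id)) := by
    rw [map_fst_roundLaw]
    exact integrable_importanceWeight_mul_exp (condFDiv_ne_top_of_logDiv_ne_top h)
  have hgM : ∫ z, g (Prod.map Prod.fst id z) ∂(B.roundLaw j) = Real.exp (B.M k j - 1) := by
    rw [← integral_map hφ.aemeasurable hg.aestronglyMeasurable, map_fst_roundLaw]
    exact integral_importanceWeight_mul_exp h
  have hbias := sub_le_integral_clip_importanceWeight_mul measurable_reward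
    (fun z => (z.1.2 z.2).2) (ae_roundExpert_absolutelyContinuous h)
    (mul_nonneg (zero_le_one.trans hL) hM.le) (hg.comp_measurable hφ)
  have hexp : Real.exp (1 - L * B.M k j) * Real.exp (B.M k j - 1) ≤ Real.exp (1 - L) := by
    rw [← Real.exp_add]
    gcongr
    nlinarith
  simp only [clippedReward]
  rw [integral_const_mul, one_div_mul_eq_div]
  gcongr
  calc B.meanReward k - Real.exp (1 - L)
      ≤ B.meanReward k - Real.exp (1 - L * B.M k j) * Real.exp (B.M k j - 1) := by gcongr
    _ ≤ _ := by rw [← hgM]; exact hbias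

end ClippedReward

end ExpertBandit

namespace ExpertBandit

variable {𝒳 : Type*} [MeasurableSpace 𝒳] {K N : ℕ} {B : ExpertBandit 𝒳 K N} {e : ℕ → Fin N}
  {z : ℕ → (𝒳 × (Fin K → unitInterval)) × Fin K} {k : Fin N} {t : ℕ}

section Width

lemma Z_eq_sum (B : ExpertBandit 𝒳 K N) (e : ℕ → Fin N) (k : Fin N) (t : ℕ) :
    B.Z e k t = ∑ s ∈ Finset.Icc 1 t, 1 / B.M k (e s) := by
  rw [Z, ← Finset.sum_fiberwise (Finset.Icc 1 t) e]
  refine Finset.sum_congr rfl fun j _ => ?_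
  rw [Finset.sum_congr rfl (g := fun _ => 1 / B.M k j) fun s hs => by
    rw [(Finset.mem_filter.1 hs).2], Finset.sum_const, pullCount, nsmul_eq_mul, mul_one_div]

variable (h : ∀ j, B.logDiv k j ≠ ⊤)

include h

lemma maxM_pos : 0 < B.maxM :=
  zero_lt_one.trans_le ((one_le_M (h k)).trans (M_le_maxM k k))

lemma Z_le (e : ℕ → Fin N) (t : ℕ) : B.Z e k t ≤ t := by
  rw [Z_eq_sum]
  calc ∑ s ∈ Finset.Icc 1 t, 1 / B.M k (e s) ≤ ∑ _s ∈ Finset.Icc 1 t, (1 : ℝ) :=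
        Finset.sum_le_sum fun s _ => div_le_one_of_le₀ (one_le_M (h _))
          (zero_le_one.trans (one_le_M (h _)))
    _ = t := by simp

lemma div_maxM_le_Z (e : ℕ → Fin N) (t : ℕ) : t / B.maxM ≤ B.Z e k t := by
  rw [Z_eq_sum]
  calc (t : ℝ) / B.maxM = ∑ _s ∈ Finset.Icc 1 t, 1 / B.maxM := by simp [div_eq_mul_inv]
    _ ≤ _ := Finset.sum_le_sum fun s _ =>
        one_div_le_one_div_of_le (zero_lt_one.trans_le (one_le_M (h _))) (M_le_maxM k (e s))

lemma Z_pos (e : ℕ → Fin N) (ht : 1 ≤ t) : 0 < B.Z e k t :=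
  (div_pos (Nat.cast_pos.2 ht) (maxM_pos h)).trans_le (div_maxM_le_Z h e t)

lemma sqrt_div_Z_pos (e : ℕ → Fin N) (ht : 2 ≤ t) :
    0 < Real.sqrt (16 * t * Real.log t) / B.Z e k t := by
  have hZ := Z_pos h e (one_le_two.trans ht)
  have hlog : 0 < Real.log t := Real.log_pos (Nat.one_lt_cast.2 ht)
  have ht0 : (0 : ℝ) < t := Nat.cast_pos.2 (zero_lt_two.trans_le ht)
  exact div_pos (Real.sqrt_pos.2 (mul_pos (mul_pos (by norm_num) ht0) hlog)) hZ

lemma beta_pos (e : ℕ → Fin N) (ht : 2 ≤ t) : 0 < B.beta e k t :=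
  (betaSol_spec (sqrt_div_Z_pos h e ht)).1

lemma beta_lt_two (e : ℕ → Fin N) (ht : 2 ≤ t) : B.beta e k t < 2 :=
  (betaSol_spec (sqrt_div_Z_pos h e ht)).2.1

lemma gammaFn_mul_le_of_le_beta (e : ℕ → Fin N) (ht : 2 ≤ t) {d : ℝ} (hd : 0 < d) (hd2 : d ≤ 2)
    (hdβ : d / 4 ≤ B.beta e k t) : t * gammaFn d ≤ 1024 * B.maxM ^ 2 * Real.log t := by
  have ht0 : (0 : ℝ) < t := Nat.cast_pos.2 (zero_lt_two.trans_le ht)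
  have hlog : 0 ≤ Real.log t := Real.log_natCast_nonneg t
  have hZ := Z_pos h e (one_le_two.trans ht)
  have hγ0 := gammaFn_pos hd (by linarith)
  have hγ := gammaFn_le_of_le_betaSol (sqrt_div_Z_pos h e ht) hd hd2 hdβ
  rw [div_pow, Real.sq_sqrt (mul_nonneg (by positivity) hlog), ← mul_div_assoc,
    le_div_iff₀ (pow_pos hZ 2)] at hγ
  have hZt : t ≤ B.Z e k t * B.maxM := (div_le_iff₀ (maxM_pos h)).1 (div_maxM_le_Z h e t)
  refine le_of_mul_le_mul_left ?_ ht0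
  calc (t : ℝ) * (t * gammaFn d) = t ^ 2 * gammaFn d := by ring
    _ ≤ (B.Z e k t * B.maxM) ^ 2 * gammaFn d := by gcongr
    _ = B.maxM ^ 2 * (gammaFn d * B.Z e k t ^ 2) := by ring
    _ ≤ B.maxM ^ 2 * (64 * (16 * t * Real.log t)) := by gcongr
    _ = t * (1024 * B.maxM ^ 2 * Real.log t) := by ring

end Width

section ClipLevel

/-- The clipping level `2 log (2 / β_k(t))` of the adaptively clipped estimator, in units of
`M_kj`. -/
noncomputable def clipLevel (B : ExpertBandit 𝒳 K N) (e : ℕ → Fin N) (k : Fin N) (t : ℕ) : ℝ :=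
  2 * Real.log (2 / B.beta e k t)

variable (h : ∀ j, B.logDiv k j ≠ ⊤)

include h

lemma clipLevel_pos (e : ℕ → Fin N) (ht : 2 ≤ t) : 0 < B.clipLevel e k t :=
  mul_pos two_pos (Real.log_pos ((one_lt_div (beta_pos h e ht)).2 (beta_lt_two h e ht)))

lemma Z_mul_beta (e : ℕ → Fin N) (ht : 2 ≤ t) :
    B.Z e k t * B.beta e k t = 2 * B.clipLevel e k t * Real.sqrt (t * Real.log t) := by
  have hβ : B.beta e k t / Real.log (2 / B.beta e k t) =
      Real.sqrt (16 * t * Real.log t) / B.Z e k t := (betaSol_spec (sqrt_div_Z_pos h e ht)).2.2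
  have hlog : 0 < Real.log (2 / B.beta e k t) := pos_of_mul_pos_right (clipLevel_pos h e ht) (by
    norm_num)
  rw [div_eq_div_iff hlog.ne' (Z_pos h e (one_le_two.trans ht)).ne',
    show (16 : ℝ) * t * Real.log t = 4 ^ 2 * (t * Real.log t) by ring,
    Real.sqrt_mul (by norm_num), Real.sqrt_sq (by norm_num)] at hβ
  rw [mul_comm, hβ, clipLevel]
  ring

lemma two_le_clipLevel (e : ℕ → Fin N) (ht : 2 ≤ t) (hβ : B.beta e k t ≤ 2 / 3) :
    2 ≤ B.clipLevel e k t := by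
  have hβ0 := beta_pos h e ht
  have hlog : Real.log 3 ≤ Real.log (2 / B.beta e k t) := by
    refine Real.log_le_log (by norm_num) ?_
    rw [le_div_iff₀ hβ0]
    linarith
  rw [clipLevel]
  linarith [Real.log_three_gt_d9]

lemma clipLevel_lt (e : ℕ → Fin N) (ht : 2 ≤ t) (hβ : B.beta e k t ≤ 2 / 3) :
    B.clipLevel e k t < t := by
  have ht2 : (2 : ℝ) ≤ t := Nat.ofNat_le_cast.2 ht
  have hβ0 := beta_pos h e ht
  have hlog : 1 / 4 ≤ Real.log t := by
    linarith [Real.log_le_log two_pos ht2, Real.log_two_gt_d9]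
  set r := Real.sqrt (t * Real.log t)
  have hr : r ^ 2 = t * Real.log t := Real.sq_sqrt (by positivity)
  have hwidth : 4 * r ≤ t * B.beta e k t := by
    calc 4 * r ≤ 2 * B.clipLevel e k t * r := by
          gcongr
          linarith [two_le_clipLevel h e ht hβ]
      _ = B.Z e k t * B.beta e k t := (Z_mul_beta h e ht).symm
      _ ≤ t * B.beta e k t := by gcongr; exact Z_le h e t
  have hsq : 4 * t ≤ t * (t * B.beta e k t ^ 2) := by
    calc 4 * t ≤ (4 * r) ^ 2 := by rw [mul_pow, hr]; nlinarith
      _ ≤ (t * B.beta e k t) ^ 2 := by gcongr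
      _ = t * (t * B.beta e k t ^ 2) := by ring
  calc B.clipLevel e k t = Real.log ((2 / B.beta e k t) ^ 2) := by
        rw [Real.log_pow, clipLevel, Nat.cast_ofNat]
    _ ≤ Real.log t := by
        refine Real.log_le_log (by positivity) ?_
        rw [div_pow, div_le_iff₀ (by positivity)]
        nlinarith
    _ < t := (Real.log_le_sub_one_of_pos (by linarith)).trans_lt (sub_one_lt _)

end ClipLevel

section Index

/-- The index `U_k(t)` as a function of the invoked experts `e s` and of the samples
`z s = ((context, reward vector), arm)` of the rounds `s = 1, …, t`. -/
noncomputable def sampleUCB (B : ExpertBandit 𝒳 K N) (e : ℕ → Fin N)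
    (z : ℕ → (𝒳 × (Fin K → unitInterval)) × Fin K) (k : Fin N) (t : ℕ) : ℝ :=
  B.ucb (fun s => (z s).1.1) e (fun s => (z s).2) (fun s => ((z s).1.2 (z s).2 : ℝ)) k t

/-- The event that for every clipping level `i / 12` up to `t` the observed clipped rewards are
close to their conditional means. Neighbouring levels differ so little that replacing the random
level by one of them changes the bias `e^{1 - L}` by a factor less than `3`. -/
def IsConcentrated (B : ExpertBandit 𝒳 K N) (e : ℕ → Fin N)
    (z : ℕ → (𝒳 × (Fin K → unitInterval)) × Fin K) (k : Fin N) (t : ℕ) : Prop :=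
  ∀ i ∈ Finset.Icc 1 (12 * t), |centeredSum B.roundLaw (B.clippedReward k (i / 12)) e z t| <
    2 * (i / 12) * Real.sqrt (t * Real.log t)

lemma exists_nat_div_twelve_le_and_le {L : ℝ} (hL : 1 ≤ L) (hLt : L < t) :
    ∃ i : ℕ, i ∈ Finset.Icc 1 (12 * t) ∧ i + 1 ∈ Finset.Icc 1 (12 * t) ∧ (i / 12 : ℝ) ≤ L ∧
      L ≤ (i + 1 : ℕ) / 12 := by
  have hi : ⌊12 * L⌋₊ < 12 * t := (Nat.floor_lt (by linarith)).2 (by push_cast; linarith)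
  have hi1 : 1 ≤ ⌊12 * L⌋₊ := Nat.le_floor (by push_cast; linarith)
  refine ⟨⌊12 * L⌋₊, Finset.mem_Icc.2 ⟨hi1, hi.le⟩, Finset.mem_Icc.2 ⟨by lia, hi⟩, ?_, ?_⟩
  · linarith [Nat.floor_le (show 0 ≤ 12 * L by linarith)]
  · push_cast
    linarith [Nat.lt_floor_add_one (12 * L)]

variable (h : ∀ j, B.logDiv k j ≠ ⊤)

include h

lemma Z_mul_sampleUCB (z : ℕ → (𝒳 × (Fin K → unitInterval)) × Fin K) (ht : 2 ≤ t) :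
    B.Z e k t * B.sampleUCB e z k t =
      ∑ s ∈ Finset.Icc 1 t, B.clippedReward k (B.clipLevel e k t) (e s) (z s) +
        3 / 2 * (B.Z e k t * B.beta e k t) := by
  have hZ := Z_pos h e (one_le_two.trans ht)
  rw [sampleUCB, ucb, mul_add, mul_left_comm, add_left_inj, clippedEst, ← mul_assoc, mul_one_div,
    div_self hZ.ne', one_mul, ← Finset.sum_fiberwise (Finset.Icc 1 t) e]
  refine Finset.sum_congr rfl fun j _ => Finset.sum_congr rfl fun s hs => ?_
  rw [(Finset.mem_filter.1 hs).2]
  simp only [clippedReward, clip, importanceWeight, prob, clipLevel, (beta_pos h e ht).ne',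
    false_or]
  by_cases hw : (B.expert k (z s).1.1).real {(z s).2} / (B.expert j (z s).1.1).real {(z s).2} ≤
      2 * Real.log (2 / B.beta e k t) * B.M k j
  · simp only [hw, if_true]
    ring
  · simp only [hw, if_false]
    ring

lemma beta_le_sampleUCB (z : ℕ → (𝒳 × (Fin K → unitInterval)) × Fin K) (ht : 2 ≤ t) :
    3 / 2 * B.beta e k t ≤ B.sampleUCB e z k t := by
  refine le_of_mul_le_mul_left ?_ (Z_pos h e (one_le_two.trans ht))
  rw [Z_mul_sampleUCB h z ht, mul_left_comm, le_add_iff_nonneg_left]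
  exact Finset.sum_nonneg fun s _ =>
    (clippedReward_mem_Icc (h _) (clipLevel_pos h e ht).le _).1

lemma Z_mul_sub_le_sum_integral_clippedReward (e : ℕ → Fin N) {L : ℝ} (hL : 1 ≤ L) :
    B.Z e k t * (B.meanReward k - Real.exp (1 - L)) ≤
      ∑ s ∈ Finset.Icc 1 t, ∫ y, B.clippedReward k L (e s) y ∂(B.roundLaw (e s)) := by
  rw [Z_eq_sum, Finset.sum_mul]
  refine Finset.sum_le_sum fun s _ => ?_
  rw [one_div_mul_eq_div]
  exact le_integral_clippedReward (h _) hL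

lemma sum_integral_clippedReward_le_Z_mul (e : ℕ → Fin N) {L : ℝ} (hL : 0 ≤ L) :
    ∑ s ∈ Finset.Icc 1 t, ∫ y, B.clippedReward k L (e s) y ∂(B.roundLaw (e s)) ≤
      B.Z e k t * B.meanReward k := by
  rw [Z_eq_sum, Finset.sum_mul]
  refine Finset.sum_le_sum fun s _ => ?_
  rw [one_div_mul_eq_div]
  exact integral_clippedReward_le (h _) hL

lemma sum_clippedReward_le_sum_clippedReward {L L' : ℝ} (hL : L ≤ L') :
    ∑ s ∈ Finset.Icc 1 t, B.clippedReward k L (e s) (z s) ≤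
      ∑ s ∈ Finset.Icc 1 t, B.clippedReward k L' (e s) (z s) :=
  Finset.sum_le_sum fun _ _ => clippedReward_le_clippedReward (h _) hL _

lemma meanReward_le_sampleUCB (ht : 2 ≤ t) (hz : B.IsConcentrated e z k t) :
    B.meanReward k ≤ B.sampleUCB e z k t := by
  rcases le_total (2 / 3) (B.beta e k t) with hβ | hβ
  · linarith [B.meanReward_le_one k, beta_le_sampleUCB h z ht (e := e)]
  have hZ := Z_pos h e (one_le_two.trans ht)
  have hL2 := two_le_clipLevel h e ht hβ
  obtain ⟨i, hi, -, hiL, hLi⟩ :=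
    exists_nat_div_twelve_le_and_le (by linarith) (clipLevel_lt h e ht hβ)
  push_cast at hLi
  have hdev := (abs_lt.1 (hz i hi)).1
  rw [centeredSum, Finset.sum_sub_distrib] at hdev
  have hdevβ : 2 * (i / 12) * Real.sqrt (t * Real.log t) ≤ B.Z e k t * B.beta e k t := by
    rw [Z_mul_beta h e ht]
    gcongr
  have hmean : B.Z e k t * (B.meanReward k - B.beta e k t / 2) ≤ ∑ s ∈ Finset.Icc 1 t,
      ∫ y, B.clippedReward k (i / 12) (e s) y ∂(B.roundLaw (e s)) := by
    refine le_trans ?_ (Z_mul_sub_le_sum_integral_clippedReward h e (by linarith))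
    gcongr
    exact exp_one_sub_le_half (beta_pos h e ht) hβ (by rw [← clipLevel]; linarith)
  refine le_of_mul_le_mul_left ?_ hZ
  rw [Z_mul_sampleUCB h z ht]
  linarith [sum_clippedReward_le_sum_clippedReward h hiL (t := t) (e := e) (z := z)]

lemma sampleUCB_le_meanReward_add (ht : 2 ≤ t) (hz : B.IsConcentrated e z k t)
    (hβ : B.beta e k t ≤ 2 / 3) :
    B.sampleUCB e z k t ≤ B.meanReward k + 7 / 2 * B.beta e k t := by
  have hL2 := two_le_clipLevel h e ht hβ
  obtain ⟨i, -, hi, hiL, hLi⟩ :=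
    exists_nat_div_twelve_le_and_le (by linarith) (clipLevel_lt h e ht hβ)
  have hdev := (abs_lt.1 (hz (i + 1) hi)).2
  rw [centeredSum, Finset.sum_sub_distrib] at hdev
  have hdevβ : 2 * ((i + 1 : ℕ) / 12) * Real.sqrt (t * Real.log t) ≤
      2 * (B.Z e k t * B.beta e k t) := by
    rw [Z_mul_beta h e ht, ← mul_assoc]
    push_cast
    gcongr
    linarith
  refine le_of_mul_le_mul_left ?_ (Z_pos h e (one_le_two.trans ht))
  rw [Z_mul_sampleUCB h z ht]
  linarith [sum_clippedReward_le_sum_clippedReward h hLi (t := t) (e := e) (z := z),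
    sum_integral_clippedReward_le_Z_mul h e (t := t) (L := (i + 1 : ℕ) / 12) (by positivity)]

end Index

end ExpertBandit

lemma two_mul_exp_neg_hoeffding {L : ℝ} (hL : 0 < L) {t : ℕ} (ht : 0 < t) :
    2 * Real.exp (-(2 * (2 * L * Real.sqrt (t * Real.log t)) ^ 2 / (t * (L - 0) ^ 2))) =
      2 / t ^ 8 := by
  have ht0 : (0 : ℝ) < t := Nat.cast_pos.2 ht
  have hexp : 2 * (2 * L * Real.sqrt (t * Real.log t)) ^ 2 / (t * (L - 0) ^ 2) =
      (8 : ℕ) * Real.log t := by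
    rw [sub_zero, mul_pow, Real.sq_sqrt (mul_nonneg ht0.le (Real.log_natCast_nonneg t)),
      div_eq_iff (by positivity)]
    push_cast
    ring
  rw [hexp, Real.exp_neg, Real.exp_nat_mul, Real.exp_log ht0, div_eq_mul_inv]

namespace ExpertBandit

variable {𝒳 Ω : Type*} [MeasurableSpace 𝒳] {mΩ : MeasurableSpace Ω} {P : Measure Ω}
  {ℱ : Filtration ℕ mΩ} {K N T t : ℕ} {B : ExpertBandit 𝒳 K N} {E : ℕ → Ω → Fin N}
  {W : ℕ → Ω → (𝒳 × (Fin K → unitInterval)) × Fin K} {k : Fin N}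

lemma setOf_not_isConcentrated (B : ExpertBandit 𝒳 K N) (E : ℕ → Ω → Fin N)
    (W : ℕ → Ω → (𝒳 × (Fin K → unitInterval)) × Fin K) (k : Fin N) (t : ℕ) :
    {ω | ¬ B.IsConcentrated (E · ω) (W · ω) k t} =
      ⋃ i ∈ Finset.Icc 1 (12 * t), {ω | 2 * (i / 12) * Real.sqrt (t * Real.log t) ≤
        |centeredSum B.roundLaw (B.clippedReward k (i / 12)) (E · ω) (W · ω) t|} := by
  ext ω
  simp only [IsConcentrated, Set.mem_ofPred_eq, not_forall, not_lt, Set.mem_iUnion]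

lemma measurableSet_not_isConcentrated (hW : IsAdaptiveSample P ℱ B.roundLaw T E W) (k : Fin N)
    (htT : t ≤ T) : MeasurableSet {ω | ¬ B.IsConcentrated (E · ω) (W · ω) k t} := by
  rw [setOf_not_isConcentrated]
  refine Finset.measurableSet_biUnion _ fun i _ => measurableSet_le measurable_const ?_
  exact continuous_abs.measurable.comp
    (hW.measurable_centeredSum (B.measurable_clippedReward k _) htT)

lemma measureReal_not_isConcentrated_le [IsProbabilityMeasure P]
    (hW : IsAdaptiveSample P ℱ B.roundLaw T E W) (h : ∀ j, B.logDiv k j ≠ ⊤) (ht : 2 ≤ t)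
    (htT : t ≤ T) : P.real {ω | ¬ B.IsConcentrated (E · ω) (W · ω) k t} ≤ 1 / t ^ 2 := by
  have ht2 : (2 : ℝ) ≤ t := Nat.ofNat_le_cast.2 ht
  have htail : ∀ i ∈ Finset.Icc 1 (12 * t), P.real {ω | 2 * (i / 12) *
      Real.sqrt (t * Real.log t) ≤
        |centeredSum B.roundLaw (B.clippedReward k (i / 12)) (E · ω) (W · ω) t|} ≤ 2 / t ^ 8 := by
    intro i hi
    have hL : (0 : ℝ) < i / 12 := div_pos (Nat.cast_pos.2 (Finset.mem_Icc.1 hi).1) (by norm_num)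
    rw [← two_mul_exp_neg_hoeffding hL (zero_lt_two.trans_le ht)]
    exact hW.measureReal_le_abs_centeredSum_le (B.measurable_clippedReward k _)
      (fun j => clippedReward_mem_Icc (h j) hL.le) htT (by positivity)
  rw [setOf_not_isConcentrated]
  calc P.real (⋃ i ∈ Finset.Icc 1 (12 * t), {ω | 2 * (i / 12) * Real.sqrt (t * Real.log t) ≤
        |centeredSum B.roundLaw (B.clippedReward k (i / 12)) (E · ω) (W · ω) t|})
      ≤ ∑ _i ∈ Finset.Icc 1 (12 * t), 2 / (t : ℝ) ^ 8 :=
        (measureReal_biUnion_finset_le _ _).trans (Finset.sum_le_sum htail)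
    _ = 24 * t / t ^ 8 := by simp; ring
    _ ≤ 1 / t ^ 2 := by
        have h5 : (2 : ℝ) ^ 5 ≤ (t : ℝ) ^ 5 := by gcongr
        rw [div_le_div_iff₀ (by positivity) (by positivity), one_mul]
        calc 24 * (t : ℝ) * (t : ℝ) ^ 2 = 24 * (t : ℝ) ^ 3 := by ring
          _ ≤ (t : ℝ) ^ 5 * (t : ℝ) ^ 3 := by gcongr; linarith
          _ = (t : ℝ) ^ 8 := by ring

end ExpertBandit

lemma integral_comp_le_add_mul_sum {Ω ι : Type*} {mΩ : MeasurableSpace Ω} {P : Measure Ω}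
    [IsProbabilityMeasure P] [Fintype ι] {E : Ω → ι} {g : ι → ℝ} (hg : ∀ k, 0 ≤ g k)
    {A : ι → Set Ω} (hA : ∀ k, MeasurableSet (A k)) {p D : ℝ} (hD : 0 ≤ D)
    (hp : ∀ k, P.real (A k) ≤ p)
    (h : ∀ᵐ ω ∂P, ω ∉ A (E ω) → g (E ω) ≤ D) :
    ∫ ω, g (E ω) ∂P ≤ D + p * ∑ k, g k := by
  have hint : ∀ k ∈ Finset.univ, Integrable ((A k).indicator fun _ => g k) P := fun k _ =>
    (integrable_const _).indicator (hA k)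
  have hle : ∀ᵐ ω ∂P, g (E ω) ≤ D + ∑ k, (A k).indicator (fun _ => g k) ω := by
    filter_upwards [h] with ω hω
    have hnonneg : ∀ k ∈ Finset.univ, 0 ≤ (A k).indicator (fun _ => g k) ω := fun k _ =>
      Set.indicator_nonneg (fun _ _ => hg k) ω
    by_cases hmem : ω ∈ A (E ω)
    · have hsingle := Finset.single_le_sum hnonneg (Finset.mem_univ (E ω))
      rw [Set.indicator_of_mem hmem] at hsingle
      linarith
    · linarith [hω hmem, Finset.sum_nonneg hnonneg]
  calc ∫ ω, g (E ω) ∂P ≤ ∫ ω, D + ∑ k, (A k).indicator (fun _ => g k) ω ∂P :=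
        integral_mono_of_nonneg (.of_forall fun ω => hg _)
          ((integrable_const D).add (integrable_finsetSum _ hint)) hle
    _ = D + ∑ k, P.real (A k) * g k := by
        rw [integral_add (integrable_const D) (integrable_finsetSum _ hint),
          integral_finsetSum _ hint]
        simp [integral_indicator_const, hA]
    _ ≤ D + p * ∑ k, g k := by
        rw [Finset.mul_sum]
        gcongr with k
        · exact hg k
        · exact hp k

section Summation

lemma sum_Icc_two_sub_pred (d : ℕ → ℝ) {n : ℕ} (hn : 1 ≤ n) :
    ∑ k ∈ Finset.Icc 2 n, (d k - d (k - 1)) = d n - d 1 := by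
  induction n, hn using Nat.le_induction with
  | base => simp
  | succ n hn ih => rw [Finset.sum_Icc_succ_top (by lia), ih, Nat.add_sub_cancel]; ring

lemma sum_Icc_two_sub_pred_mul {d : ℕ → ℝ} (hd : d 1 = 0) (τ : ℕ → ℝ) {n : ℕ} (hn : 1 ≤ n) :
    ∑ k ∈ Finset.Icc 2 n, (d k - d (k - 1)) * τ k =
      d n * τ n + ∑ k ∈ Finset.Icc 2 (n - 1), d k * (τ k - τ (k + 1)) := by
  induction n, hn using Nat.le_induction with
  | base => simp [hd]
  | succ n hn ih =>
    rw [Finset.sum_Icc_succ_top (by lia), ih, Nat.add_sub_cancel]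
    rcases hn.eq_or_lt with rfl | hn
    · simp [hd]
    · obtain ⟨m, rfl⟩ : ∃ m, n = m + 1 := Nat.exists_eq_add_of_le' (by lia)
      rw [Finset.sum_Icc_succ_top (by lia), Nat.add_sub_cancel]
      ring

lemma sum_Icc_two_ite_le_le {τ : ℝ} (hτ : 0 ≤ τ) (n : ℕ) :
    ∑ t ∈ Finset.Icc 2 n, (if (t : ℝ) ≤ τ then (1 : ℝ) else 0) ≤ τ := by
  rw [Finset.sum_boole]
  have hsub : (Finset.Icc 2 n).filter (fun t : ℕ => (t : ℝ) ≤ τ) ⊆ Finset.Icc 1 ⌊τ⌋₊ := by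
    intro t ht
    rw [Finset.mem_filter, Finset.mem_Icc] at ht
    exact Finset.mem_Icc.2 ⟨by lia, Nat.le_floor ht.2⟩
  refine le_trans (Nat.cast_le.2 ((Finset.card_le_card hsub).trans_eq ?_)) (Nat.floor_le hτ)
  rw [Nat.card_Icc, Nat.add_sub_cancel]

lemma one_add_sum_Icc_two_one_div_sq_le (n : ℕ) :
    1 + ∑ t ∈ Finset.Icc 2 n, 1 / (t : ℝ) ^ 2 ≤ Real.pi ^ 2 / 6 := by
  have hsum := sum_le_hasSum (insert 1 (Finset.Icc 2 n)) (fun _ _ => by positivity) hasSum_zeta_two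
  rw [Finset.sum_insert (by simp)] at hsum
  simpa using hsum

lemma sum_Icc_one_le_two_mul_add {f b : ℕ → ℝ} {S : ℝ} {T : ℕ} (hS : 0 ≤ S)
    (hf : ∀ t ∈ Finset.Icc 1 T, f t ≤ S) (hb : ∀ t, 2 ≤ t → t + 1 ≤ T → f (t + 1) ≤ b t) :
    ∑ t ∈ Finset.Icc 1 T, f t ≤ 2 * S + ∑ t ∈ Finset.Icc 2 (T - 1), b t := by
  induction T with
  | zero => simpa using hS
  | succ T ih =>
    have ih := ih (fun t ht => hf t (Finset.Icc_subset_Icc_right T.le_succ ht))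
      fun t h2 ht => hb t h2 (ht.trans T.le_succ)
    rcases lt_or_ge T 2 with hT | hT
    · have hcard := Finset.sum_le_card_nsmul _ _ _ hf
      have hT2 : ((T + 1 : ℕ) : ℝ) ≤ 2 := Nat.cast_le_ofNat.2 hT
      rw [Nat.card_Icc, Nat.add_sub_cancel, nsmul_eq_mul] at hcard
      rw [Nat.add_sub_cancel, Finset.Icc_eq_empty_of_lt hT, Finset.sum_empty, add_zero]
      exact hcard.trans (mul_le_mul_of_nonneg_right hT2 hS)
    · obtain ⟨n, rfl⟩ : ∃ n, T = n + 1 := Nat.exists_eq_add_of_le' (one_le_two.trans hT)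
      rw [Finset.sum_Icc_succ_top (by lia), Nat.add_sub_cancel, Finset.sum_Icc_succ_top hT]
      rw [Nat.add_sub_cancel] at ih
      linarith [hb (n + 1) hT le_rfl]

end Summation

section ActiveGap

/-- The largest of the gaps `d 1 ≤ ⋯ ≤ d N` whose threshold `τ k` has not been passed at time `t`.
It is encoded as a telescoping sum, which is that maximum when `d 1 = 0` and `τ` is antitone, so
that summing over `t` gives `∑ (d k - d (k - 1)) τ k`. -/
noncomputable def activeGap (d τ : ℕ → ℝ) (N t : ℕ) : ℝ :=
  ∑ k ∈ Finset.Icc 2 N, (d k - d (k - 1)) * (if (t : ℝ) ≤ τ k then 1 else 0)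

variable {d τ : ℕ → ℝ} {N : ℕ}

lemma sub_pred_nonneg (hd : MonotoneOn d (Set.Icc 1 N)) {k : ℕ} (hk : k ∈ Finset.Icc 2 N) :
    0 ≤ d k - d (k - 1) := by
  rw [Finset.mem_Icc] at hk
  exact sub_nonneg.2 (hd ⟨by lia, by lia⟩ ⟨by lia, hk.2⟩ (Nat.sub_le k 1))

lemma activeGap_term_nonneg (hd : MonotoneOn d (Set.Icc 1 N)) {k : ℕ} (hk : k ∈ Finset.Icc 2 N)
    (t : ℕ) : 0 ≤ (d k - d (k - 1)) * (if (t : ℝ) ≤ τ k then 1 else 0) :=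
  mul_nonneg (sub_pred_nonneg hd hk) (by positivity)

lemma activeGap_nonneg (hd : MonotoneOn d (Set.Icc 1 N)) (t : ℕ) : 0 ≤ activeGap d τ N t :=
  Finset.sum_nonneg fun _ hk => activeGap_term_nonneg hd hk t

lemma le_activeGap (hd1 : d 1 = 0) (hd : MonotoneOn d (Set.Icc 1 N)) {n t : ℕ} (hn1 : 1 ≤ n)
    (hnN : n ≤ N) (ht : ∀ k ∈ Finset.Icc 2 n, 0 < d k → t ≤ τ k) : d n ≤ activeGap d τ N t := by
  calc d n = ∑ k ∈ Finset.Icc 2 n, (d k - d (k - 1)) := by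
        rw [sum_Icc_two_sub_pred d hn1, hd1, sub_zero]
    _ ≤ ∑ k ∈ Finset.Icc 2 n, (d k - d (k - 1)) * (if (t : ℝ) ≤ τ k then 1 else 0) := by
        refine Finset.sum_le_sum fun k hk => ?_
        by_cases hτ : t ≤ τ k
        · rw [if_pos hτ, mul_one]
        · have hdk : d k ≤ 0 := not_lt.1 fun h0 => hτ (ht k hk h0)
          rw [Finset.mem_Icc] at hk
          have hpred : d 1 ≤ d (k - 1) := hd ⟨le_rfl, by lia⟩ ⟨by lia, by lia⟩ (by lia)
          rw [if_neg hτ, mul_zero]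
          linarith
    _ ≤ activeGap d τ N t :=
        Finset.sum_le_sum_of_subset_of_nonneg (Finset.Icc_subset_Icc_right hnN)
          fun k hk _ => activeGap_term_nonneg hd hk t

lemma sum_activeGap_le (hd : MonotoneOn d (Set.Icc 1 N)) (hτ : ∀ k, 0 ≤ τ k) (n : ℕ) :
    ∑ t ∈ Finset.Icc 2 n, activeGap d τ N t ≤
      ∑ k ∈ Finset.Icc 2 N, (d k - d (k - 1)) * τ k := by
  simp only [activeGap]
  rw [Finset.sum_comm]
  refine Finset.sum_le_sum fun k hk => ?_
  rw [← Finset.mul_sum]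
  exact mul_le_mul_of_nonneg_left (sum_Icc_two_ite_le_le (hτ k) n) (sub_pred_nonneg hd hk)

lemma mul_div_gammaFn (Q x : ℝ) : x * (Q / gammaFn x) = Q * Real.log (6 / x) ^ 2 / x := by
  rcases eq_or_ne x 0 with rfl | hx
  · simp
  · rw [gammaFn, div_div_eq_mul_div]
    field_simp

lemma sum_sub_pred_mul_div_gammaFn (hd1 : d 1 = 0) (hN : 1 ≤ N) (hd : MonotoneOn d (Set.Icc 1 N))
    (hd6 : ∀ k ∈ Set.Icc 1 N, d k < 6) (Q : ℝ) :
    ∑ k ∈ Finset.Icc 2 N, (d k - d (k - 1)) * (Q / gammaFn (d k)) =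
      Q * Real.log (6 / d N) ^ 2 / d N + ∑ k ∈ Finset.Icc 2 (N - 1),
        Q * Real.log (6 / d k) ^ 2 / d k * (1 - gammaFn (d k) / gammaFn (d (k + 1))) := by
  rw [sum_Icc_two_sub_pred_mul hd1 (fun k => Q / gammaFn (d k)) hN, mul_div_gammaFn]
  congr 1
  refine Finset.sum_congr rfl fun k hk => ?_
  rw [Finset.mem_Icc] at hk
  have hk1 : k ∈ Set.Icc 1 N := ⟨by lia, by lia⟩
  have h0 : 0 ≤ d k := hd1 ▸ hd ⟨le_rfl, hN⟩ hk1 hk1.1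
  rw [← mul_div_gammaFn]
  rcases h0.eq_or_lt with h0 | h0
  · simp [← h0]
  · have hγ := (gammaFn_pos h0 (hd6 k hk1)).ne'
    field_simp

end ActiveGap

namespace ExpertBandit

variable {𝒳 : Type*} [MeasurableSpace 𝒳] {K N : ℕ} (B : ExpertBandit 𝒳 K N)

section Gap

lemma meanReward_le_bestMean (k : Fin N) : B.meanReward k ≤ B.bestMean :=
  le_ciSup (Set.finite_range _).bddAbove k

lemma gap_nonneg (k : Fin N) : 0 ≤ B.gap k := sub_nonneg.2 (B.meanReward_le_bestMean k)

lemma sum_gap_nonneg : 0 ≤ ∑ k, B.gap k := Finset.sum_nonneg fun k _ => B.gap_nonneg k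

lemma gap_le_sum_gap (k : Fin N) : B.gap k ≤ ∑ l, B.gap l :=
  Finset.single_le_sum (fun l _ => B.gap_nonneg l) (Finset.mem_univ k)

lemma exists_meanReward_eq_bestMean (hN : 1 ≤ N) : ∃ k, B.meanReward k = B.bestMean :=
  have : Nonempty (Fin N) := ⟨⟨0, hN⟩⟩
  exists_eq_ciSup_of_finite

lemma gap_le_one (k : Fin N) : B.gap k ≤ 1 := by
  obtain ⟨l, hl⟩ := B.exists_meanReward_eq_bestMean (Nat.one_le_of_lt k.2)
  rw [gap, ← hl]
  linarith [B.meanReward_le_one l, B.meanReward_nonneg k]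

lemma orderedGap_succ (i : Fin N) : B.orderedGap (i + 1) = B.gap (Tuple.sort B.gap i) := by
  rw [orderedGap, dif_pos ⟨by lia, by lia⟩]
  rfl

lemma gap_eq_orderedGap (k : Fin N) :
    B.gap k = B.orderedGap ((Tuple.sort B.gap).symm k + 1) := by
  rw [orderedGap_succ, Equiv.apply_symm_apply]

lemma orderedGap_nonneg (k : ℕ) : 0 ≤ B.orderedGap k := by
  unfold orderedGap
  split_ifs
  exacts [B.gap_nonneg _, le_rfl]

lemma orderedGap_le_one (k : ℕ) : B.orderedGap k ≤ 1 := by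
  unfold orderedGap
  split_ifs
  exacts [B.gap_le_one _, zero_le_one]

lemma monotoneOn_orderedGap : MonotoneOn B.orderedGap (Set.Icc 1 N) := by
  intro i hi j hj hij
  rw [Set.mem_Icc] at hi hj
  rw [orderedGap, dif_pos hi, orderedGap, dif_pos hj]
  exact Tuple.monotone_sort B.gap (Fin.mk_le_mk.2 (Nat.sub_le_sub_right hij 1))

lemma orderedGap_one (hN : 1 ≤ N) : B.orderedGap 1 = 0 := by
  obtain ⟨k, hk⟩ := B.exists_meanReward_eq_bestMean hN
  refine le_antisymm ?_ (B.orderedGap_nonneg 1)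
  calc B.orderedGap 1 ≤ B.orderedGap ((Tuple.sort B.gap).symm k + 1) :=
        B.monotoneOn_orderedGap ⟨le_rfl, hN⟩ ⟨by lia, by lia⟩ (by lia)
    _ = 0 := by rw [← gap_eq_orderedGap, gap, hk, sub_self]

lemma sum_gap_eq_sum_orderedGap (hN : 1 ≤ N) :
    ∑ k, B.gap k = ∑ i ∈ Finset.Icc 2 N, B.orderedGap i := by
  calc ∑ k, B.gap k = ∑ i : Fin N, B.orderedGap (i + 1) := by
        rw [← Equiv.sum_comp (Tuple.sort B.gap) B.gap]
        exact Finset.sum_congr rfl fun i _ => (B.orderedGap_succ i).symm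
    _ = ∑ i ∈ Finset.range N, B.orderedGap (i + 1) :=
        Fin.sum_univ_eq_sum_range (fun i => B.orderedGap (i + 1)) N
    _ = ∑ i ∈ Finset.Icc 1 N, B.orderedGap i := by
        rw [Finset.range_eq_Ico, Finset.sum_Ico_add' B.orderedGap 0 N 1]
        rfl
    _ = ∑ i ∈ Finset.Icc 2 N, B.orderedGap i := by
        rw [← Finset.add_sum_Ioc_eq_sum_Icc hN, B.orderedGap_one hN, zero_add]
        rfl

end Gap

variable {B}

lemma mul_gammaFn_gap_le_of_sampleUCB_le (hfin : ∀ i j, B.logDiv i j ≠ ⊤) {e : ℕ → Fin N}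
    {z : ℕ → (𝒳 × (Fin K → unitInterval)) × Fin K} {b k : Fin N} {t : ℕ} (ht : 2 ≤ t)
    (hb : B.meanReward b = B.bestMean) (hzb : B.IsConcentrated e z b t)
    (hzk : B.IsConcentrated e z k t) (hle : B.sampleUCB e z b t ≤ B.sampleUCB e z k t)
    (hgap : 0 < B.gap k) : t * gammaFn (B.gap k) ≤ 1024 * B.maxM ^ 2 * Real.log t := by
  have hgap1 := B.gap_le_one k
  refine gammaFn_mul_le_of_le_beta (hfin k) e ht hgap (by linarith) ?_
  rcases le_total (2 / 3) (B.beta e k t) with hβ | hβ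
  · linarith
  · have hlower := meanReward_le_sampleUCB (hfin b) ht hzb
    have hupper := sampleUCB_le_meanReward_add (hfin k) ht hzk hβ
    have hβ0 := beta_pos (hfin k) e ht
    rw [gap, ← hb]
    linarith

lemma gap_le_activeGap {Q : ℝ} {t : ℕ} {k : Fin N}
    (hk : 0 < B.gap k → t * gammaFn (B.gap k) ≤ Q) :
    B.gap k ≤ activeGap B.orderedGap (fun i => Q / gammaFn (B.orderedGap i)) N t := by
  rw [gap_eq_orderedGap] at hk ⊢
  set n : ℕ := (Tuple.sort B.gap).symm k + 1
  have hn1 : 1 ≤ n := Nat.le_add_left 1 _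
  have hnN : n ≤ N := ((Tuple.sort B.gap).symm k).2
  refine le_activeGap (B.orderedGap_one (hn1.trans hnN)) B.monotoneOn_orderedGap hn1 hnN
    fun i hi h0 => ?_
  rw [Finset.mem_Icc] at hi
  have hin : B.orderedGap i ≤ B.orderedGap n :=
    B.monotoneOn_orderedGap ⟨by lia, by lia⟩ ⟨hn1, hnN⟩ hi.2
  have hn6 : B.orderedGap n < 6 := by linarith [B.orderedGap_le_one n]
  rw [le_div_iff₀ (gammaFn_pos h0 (hin.trans_lt hn6))]
  calc t * gammaFn (B.orderedGap i) ≤ t * gammaFn (B.orderedGap n) := by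
        gcongr
        exact gammaFn_le_gammaFn h0 hin hn6
    _ ≤ Q := hk (h0.trans_le hin)

namespace IsDUCBRun

variable {Ω : Type*} {mΩ : MeasurableSpace Ω} {P : Measure Ω} {ℱ : Filtration ℕ mΩ} {T t : ℕ}
  {X : ℕ → Ω → 𝒳} {R : ℕ → Ω → Fin K → unitInterval} {E : ℕ → Ω → Fin N} {V : ℕ → Ω → Fin K}

lemma isAdaptiveSample (h : B.IsDUCBRun P ℱ T X R E V) :
    IsAdaptiveSample P ℱ B.roundLaw T E fun t ω => ((X t ω, R t ω), V t ω) where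
  measurable_index := h.expert_meas
  measurable_sample t h1 ht :=
    ((h.context_meas t h1 ht).prodMk (h.reward_meas t h1 ht)).prodMk (h.arm_meas t h1 ht)
  map_restrict := h.round_law

variable [IsProbabilityMeasure P]

lemma integrable_gap (h : B.IsDUCBRun P ℱ T X R E V) (ht : t ∈ Finset.Icc 1 T) :
    Integrable (fun ω => B.gap (E t ω)) P := by
  rw [Finset.mem_Icc] at ht
  have hE : Measurable (E t) := (h.expert_meas t ht.1 ht.2).mono (ℱ.le _) le_rfl
  exact Integrable.of_mem_Icc 0 1 ((Measurable.of_discrete (f := B.gap)).comp hE).aemeasurable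
    (.of_forall fun ω => ⟨B.gap_nonneg _, B.gap_le_one _⟩)

lemma integral_gap_le_sum_gap (h : B.IsDUCBRun P ℱ T X R E V) (ht : t ∈ Finset.Icc 1 T) :
    ∫ ω, B.gap (E t ω) ∂P ≤ ∑ k, B.gap k := by
  calc ∫ ω, B.gap (E t ω) ∂P ≤ ∫ _, ∑ k, B.gap k ∂P :=
        integral_mono (h.integrable_gap ht) (integrable_const _) fun ω => B.gap_le_sum_gap _
    _ = ∑ k, B.gap k := by simp

lemma integral_gap_succ_le (h : B.IsDUCBRun P ℱ T X R E V) (hN : 1 ≤ N)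
    (hfin : ∀ i j, B.logDiv i j ≠ ⊤) (ht : 2 ≤ t) (htT : t + 1 ≤ T) :
    ∫ ω, B.gap (E (t + 1) ω) ∂P ≤ activeGap B.orderedGap
      (fun i => 1024 * B.maxM ^ 2 * Real.log T / gammaFn (B.orderedGap i)) N t +
        2 * (1 / t ^ 2) * ∑ k, B.gap k := by
  obtain ⟨b, hb⟩ := B.exists_meanReward_eq_bestMean hN
  have hT : t ≤ T := Nat.le_of_succ_le htT
  set W : ℕ → Ω → (𝒳 × (Fin K → unitInterval)) × Fin K := fun t ω => ((X t ω, R t ω), V t ω)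
  have hW : IsAdaptiveSample P ℱ B.roundLaw T E W := h.isAdaptiveSample
  set bad : Fin N → Set Ω := fun k => {ω | ¬ B.IsConcentrated (E · ω) (W · ω) k t}
  have hbad : ∀ k, MeasurableSet (bad k) := fun k => measurableSet_not_isConcentrated hW k hT
  refine integral_comp_le_add_mul_sum (A := fun k => bad b ∪ bad k) B.gap_nonneg
    (fun k => (hbad b).union (hbad k)) (activeGap_nonneg B.monotoneOn_orderedGap t)
    (fun k => ?_) ?_
  · rw [two_mul]
    exact (measureReal_union_le _ _).trans (add_le_add
      (measureReal_not_isConcentrated_le hW (hfin b) ht hT)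
      (measureReal_not_isConcentrated_le hW (hfin k) ht hT))
  · filter_upwards [h.argmax (t + 1) (by lia) htT] with ω harg hω
    rw [Set.mem_union, not_or] at hω
    refine gap_le_activeGap fun hgap => (mul_gammaFn_gap_le_of_sampleUCB_le hfin ht hb
      (not_not.1 hω.1) (not_not.1 hω.2) (harg b) hgap).trans ?_
    gcongr

lemma integrable_regret (h : B.IsDUCBRun P ℱ T X R E V) :
    Integrable (fun ω => B.regret (E · ω) T) P :=
  integrable_finsetSum _ fun _ => h.integrable_gap

lemma integral_regret_le (h : B.IsDUCBRun P ℱ T X R E V) (hN : 1 ≤ N)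
    (hfin : ∀ i j, B.logDiv i j ≠ ⊤) :
    ∫ ω, B.regret (E · ω) T ∂P ≤
      ∑ k ∈ Finset.Icc 2 N, (B.orderedGap k - B.orderedGap (k - 1)) *
        (1024 * B.maxM ^ 2 * Real.log T / gammaFn (B.orderedGap k)) +
      Real.pi ^ 2 / 3 * ∑ k, B.gap k := by
  set S := ∑ k, B.gap k
  set τ : ℕ → ℝ := fun k => 1024 * B.maxM ^ 2 * Real.log T / gammaFn (B.orderedGap k)
  have hS : 0 ≤ S := B.sum_gap_nonneg
  have hτ : ∀ k, 0 ≤ τ k := fun k =>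
    div_nonneg (mul_nonneg (by positivity) (Real.log_natCast_nonneg T)) (gammaFn_nonneg _)
  calc ∫ ω, B.regret (E · ω) T ∂P = ∑ t ∈ Finset.Icc 1 T, ∫ ω, B.gap (E t ω) ∂P :=
        integral_finsetSum _ fun _ => h.integrable_gap
    _ ≤ 2 * S + ∑ t ∈ Finset.Icc 2 (T - 1),
          (activeGap B.orderedGap τ N t + 2 * (1 / t ^ 2) * S) :=
        sum_Icc_one_le_two_mul_add hS (fun t => h.integral_gap_le_sum_gap)
          fun t => h.integral_gap_succ_le hN hfin
    _ = ∑ t ∈ Finset.Icc 2 (T - 1), activeGap B.orderedGap τ N t +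
          2 * S * (1 + ∑ t ∈ Finset.Icc 2 (T - 1), 1 / (t : ℝ) ^ 2) := by
        rw [Finset.sum_add_distrib, ← Finset.sum_mul, ← Finset.mul_sum]
        ring
    _ ≤ ∑ k ∈ Finset.Icc 2 N, (B.orderedGap k - B.orderedGap (k - 1)) * τ k +
          2 * S * (Real.pi ^ 2 / 6) := by
        gcongr
        · exact sum_activeGap_le B.monotoneOn_orderedGap hτ _
        · exact one_add_sum_Icc_two_one_div_sq_le _
    _ = _ := by ring

end IsDUCBRun

end ExpertBandit

theorem theorem1 :
    ∃ C₁ : ℝ, 0 < C₁ ∧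
      ∀ (𝒳 : Type*) [MeasurableSpace 𝒳] (K N : ℕ) (_hN : 1 ≤ N) (B : ExpertBandit 𝒳 K N)
        (_hM : ∀ i j : Fin N, B.logDiv i j ≠ ⊤)
        (Ω : Type*) [mΩ : MeasurableSpace Ω] (P : Measure Ω) [IsProbabilityMeasure P]
        (ℱ : Filtration ℕ mΩ) (T : ℕ) (X : ℕ → Ω → 𝒳) (R : ℕ → Ω → Fin K → unitInterval)
        (E : ℕ → Ω → Fin N) (V : ℕ → Ω → Fin K) (_hrun : B.IsDUCBRun P ℱ T X R E V),
        Integrable (fun ω => B.regret (fun t => E t ω) T) P ∧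
        ∫ ω, B.regret (fun t => E t ω) T ∂P ≤
          C₁ * B.maxM ^ 2 * Real.log (6 / B.orderedGap N) ^ 2 * Real.log T / B.orderedGap N
          + Real.pi ^ 2 / 3 * ∑ i ∈ Finset.Icc 2 N, B.orderedGap i
          + ∑ k ∈ Finset.Icc 2 (N - 1),
              C₁ * B.maxM ^ 2 * Real.log (6 / B.orderedGap k) ^ 2 * Real.log T / B.orderedGap k
                * (1 - gammaFn (B.orderedGap k) / gammaFn (B.orderedGap (k + 1))) := by
  refine ⟨1024, by norm_num, ?_⟩
  intro 𝒳 _ K N hN B hfin Ω _ P _ ℱ T X R E V hrun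
  refine ⟨hrun.integrable_regret, (hrun.integral_regret_le hN hfin).trans_eq ?_⟩
  have hd6 : ∀ k ∈ Set.Icc 1 N, B.orderedGap k < 6 := fun k _ =>
    (B.orderedGap_le_one k).trans_lt (by norm_num)
  rw [sum_sub_pred_mul_div_gammaFn (B.orderedGap_one hN) hN B.monotoneOn_orderedGap hd6,
    B.sum_gap_eq_sum_orderedGap hN, add_right_comm]
  simp only [mul_right_comm _ (Real.log T)]
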